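/- **Setting.** Let $\mathcal X=\{1,\dots,N\}$ be the set of augmented samples. Let $\mathcal T(\cdot\mid\bar x)$ be the probability distribution on $\mathcal X$ of the augmentations of a natural sample $\bar x$, let $\mathcal P$ be the distribution of natural samples, and let $\mathcal P_{l_1}$ be the distribution of the natural samples of the (single) known class. Put $$A^{(u)}_{xx'}=\mathbb E_{\bar x\sim\mathcal P}\,\mathcal T(x\mid\bar x)\mathcal T(x'\mid\bar x),\qquad \mathfrak l_x=\mathbb E_{\bar x\sim\mathcal P_{l_1}}\mathcal T(x\mid\bar x),\qquad A(\delta)=\eta_uA^{(u)}+\delta\,\mathfrak l\mathfrak l^\top\quad(\eta_u>0),$$ let $D(\delta)$ be the diagonal matrix of the row sums of $A(\delta)$, and assume the normalization $D(0)=I_N$ (equal degrees in the unlabeled graph). Let $\tilde A(\delta)=D(\delta)^{-1/2}A(\delta)D(\delta)^{-1/2}$, which is positive semidefinite for $\delta\ge 0$, let $V_k(\delta)$ have as columns any choice of its top-$k$ orthonormal singular vectors (eigenvectors), $\Sigma_k(\delta)$ be the diagonal matrix of the corresponding singular values, and let the features $z_i(\delta)\in\mathbb R^k$ be the rows of $Z(\delta)=D(\delta)^{-1/2}V_k(\delta)\sqrt{\Sigma_k(\delta)}$,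 where $1\le k\le N$. Write $Z=Z(0)$, $z_i=z_i(0)$, $V_k^{(u)}=V_k(0)$; let $\lambda_1\ge\dots\ge\lambda_N\ge0$ be the singular values of $\tilde A(0)$, $\lambda_{N+1}=0$, and let $\mathcal G_k=\lambda_k/\lambda_{k+1}\in[1,\infty]$ be the spectral gap, where $\lambda_k>0$. Let $\Pi$ be a partition of $\mathcal X$ into non-empty classes. Write $\boldsymbol\mu_\pi$ for the mean of the features over $\pi\in\Pi$ and $\boldsymbol\mu_\Pi$ for the mean of all features, and put $$\mathcal M_{intra}(\Pi,Z)=\sum_{\pi\in\Pi}\sum_{i\in\pi}\|z_i-\boldsymbol\mu_\pi\|^2,\quad \mathcal M_{inter}(\Pi,Z)=\sum_{\pi\in\Pi}|\pi|\,\|\boldsymbol\mu_\pi-\boldsymbol\mu_\Pi\|^2,\quad \mathcal M_{kms}=\frac{\mathcal M_{intra}}{\mathcal M_{inter}},$$ $$\Delta_{kms}(\delta)=\mathcal M_{kms}(\Pi,Z)-\mathcal M_{kms}(\Pi,Z(\delta)).$$ Assume $\mathcal M_{inter}(\Pi,Z)>0$ and put $\eta_1=1/\mathcal M_{inter}(\Pi,Z)$,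 $\eta_2=\mathcal M_{intra}(\Pi,Z)/\mathcal M_{inter}(\Pi,Z)$. **Theorem.** For every $N$ there is a constant $K>0$, depending only on $N$, such that the following holds for all data as above. Assume that the spectral gap is large, $\mathcal G_k\ge2$; that $\mathfrak l$ lies in the linear span of the columns of $V_k^{(u)}$; and that $\mathfrak l$ is constant on each class $\pi_c\in\Pi$, with value $\mathfrak l_{\pi_c}$. Put $$\Delta_{\pi_c}(\delta)=\Bigl(\mathfrak l_{\pi_c}-\frac1N\Bigr)-2\Bigl(1-\frac{|\pi_c|}N\Bigr)\Bigl(\mathbb E_{i\in\pi_c}\mathbb E_{j\in\pi_c}z_i^\top z_j-\mathbb E_{i\in\pi_c}\mathbb E_{j\notin\pi_c}z_i^\top z_j\Bigr).$$ 1. There are $C$ and $\delta_0>0$ (independent of $\delta$) such that for all $0<\delta<\delta_0$ $$\Delta_{kms}(\delta)\ \ge\ \delta\,\eta_1\eta_2\sum_{\pi_c\in\Pi}|\pi_c|\,\mathfrak l_{\pi_c}\,\Delta_{\pi_c}(\delta)\;-\;K\,\eta_1(1+\eta_2)\,\frac{\delta}{\mathcal G_k}\;-\;C\,\delta^2 .$$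 2. If moreover the gap is so large that $K(1+\eta_2)/\mathcal G_k<\sum_{\pi_c\in\Pi}\mathfrak l_{\pi_c}\sum_{i\in\pi_c}\|z_i-\boldsymbol\mu_{\pi_c}\|^2$, then there is $\delta_0>0$ such that for all $0<\delta<\delta_0$ $$\Delta_{kms}(\delta)\ \ge\ \delta\,\eta_1\eta_2\sum_{\pi_c\in\Pi}|\pi_c|\,\mathfrak l_{\pi_c}\,\Delta_{\pi_c}(\delta).$$ -/

import Mathlib

open MeasureTheory ProbabilityTheory Filter Topology

noncomputable section

namespace SORL

/-! ### The augmentation graph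

Natural samples live in a measurable space `Ω`; the augmented samples are indexed by `Fin N`, and
`T ω` is the distribution of the augmentations of the natural sample `ω`. -/

section Graph

variable {Ω : Type*} [MeasurableSpace Ω] {N : ℕ}

/-- Self-supervised connectivity `A⁽ᵘ⁾_{x x'} = 𝔼_{ω ∼ P} T(x | ω) T(x' | ω)`. -/
def unlabeledAdj (P : Measure Ω) (T : Kernel Ω (Fin N)) : Matrix (Fin N) (Fin N) ℝ :=
  Matrix.of fun x x' => ∫ ω, (T ω).real {x} * (T ω).real {x'} ∂P

/-- The vector `𝔩` of connections to the labeled data, `𝔩_x = 𝔼_{ω ∼ Pl} T(x | ω)`, where `Pl` is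
the distribution of the natural samples of the (single) known class. -/
def labelVec (Pl : Measure Ω) (T : Kernel Ω (Fin N)) : Fin N → ℝ :=
  fun x => ∫ ω, (T ω).real {x} ∂Pl

/-- The perturbed adjacency matrix `A(δ) = ηᵤ A⁽ᵘ⁾ + δ 𝔩 𝔩ᵀ`. -/
def adj (P Pl : Measure Ω) (T : Kernel Ω (Fin N)) (ηu δ : ℝ) : Matrix (Fin N) (Fin N) ℝ :=
  ηu • unlabeledAdj P T + δ • Matrix.vecMulVec (labelVec Pl T) (labelVec Pl T)

end Graph

/-! ### Normalization and spectral features -/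

section Spectral

variable {N : ℕ}

/-- The degree (row sum) of a vertex. -/
def deg (A : Matrix (Fin N) (Fin N) ℝ) (x : Fin N) : ℝ := ∑ x', A x x'

/-- The normalized adjacency matrix `D^{-1/2} A D^{-1/2}`. -/
def normAdj (A : Matrix (Fin N) (Fin N) ℝ) : Matrix (Fin N) (Fin N) ℝ :=
  Matrix.of fun x x' => (√(deg A x))⁻¹ * A x x' * (√(deg A x'))⁻¹

/-- An orthonormal eigenbasis of `M` listed in order of decreasing eigenvalue. The matrices
`normAdj (adj P Pl T ηu δ)` with `ηu, δ ≥ 0` are positive semidefinite (they are normalized Gram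
matrices), so for them the eigenvalues are the singular values, and the vectors `vec j` are the
singular vectors. -/
structure EigenSystem (M : Matrix (Fin N) (Fin N) ℝ) where
  val : Fin N → ℝ
  vec : OrthonormalBasis (Fin N) ℝ (EuclideanSpace ℝ (Fin N))
  antitone_val : Antitone val
  mulVec_vec : ∀ j x, M.mulVec (fun y => vec j y) x = val j * vec j x

/-- The `i`-th largest eigenvalue `λ_i` for `1 ≤ i ≤ N` (counted from one), and `0` otherwise. -/
def EigenSystem.nth {M : Matrix (Fin N) (Fin N) ℝ} (E : EigenSystem M) (i : ℕ) : ℝ :=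
  if h : 1 ≤ i ∧ i ≤ N then E.val ⟨i - 1, by omega⟩ else 0

/-- The reciprocal `1 / 𝒢_k = λ_{k+1} / λ_k` of the spectral gap `𝒢_k = λ_k / λ_{k+1}`; it is `0`
when `λ_{k+1} = 0`, that is, when the gap is infinite. -/
def EigenSystem.invGap {M : Matrix (Fin N) (Fin N) ℝ} (E : EigenSystem M) (k : ℕ) : ℝ :=
  E.nth (k + 1) / E.nth k

/-- The linear span of the top-`k` eigenvectors, the columns of `V_k`. -/
def EigenSystem.topSpan {M : Matrix (Fin N) (Fin N) ℝ} (E : EigenSystem M) {k : ℕ} (hk : k ≤ N) :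
    Submodule ℝ (EuclideanSpace ℝ (Fin N)) :=
  Submodule.span ℝ (Set.range fun j : Fin k => E.vec (Fin.castLE hk j))

/-- The learned features: the rows `z_x ∈ ℝᵏ` of `Z = D^{-1/2} V_k √Σ_k`, where the columns of `V_k`
are the top-`k` eigenvectors of the normalized adjacency matrix and `Σ_k` is the diagonal matrix of
the corresponding eigenvalues. -/
def features {A : Matrix (Fin N) (Fin N) ℝ} (E : EigenSystem (normAdj A)) {k : ℕ} (hk : k ≤ N)
    (x : Fin N) : EuclideanSpace ℝ (Fin k) :=
  WithLp.toLp 2 fun j =>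
    (√(deg A x))⁻¹ * E.vec (Fin.castLE hk j) x * √(E.val (Fin.castLE hk j))

end Spectral

/-! ### The K-means measure -/

section KMeans

variable {N k : ℕ}

/-- The mean `μ_s = 𝔼_{i ∈ s} z_i`. -/
def mean (Z : Fin N → EuclideanSpace ℝ (Fin k)) (s : Finset (Fin N)) : EuclideanSpace ℝ (Fin k) :=
  (s.card : ℝ)⁻¹ • ∑ i ∈ s, Z i

/-- `∑_{π ∈ Cls} ∑_{i ∈ π} ‖z_i - μ_π‖²`. -/
def intraClass (Cls : Finpartition (Finset.univ : Finset (Fin N)))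
    (Z : Fin N → EuclideanSpace ℝ (Fin k)) : ℝ :=
  ∑ π ∈ Cls.parts, ∑ i ∈ π, ‖Z i - mean Z π‖ ^ 2

/-- `∑_{π ∈ Cls} |π| ‖μ_π - μ‖²`, where `μ` is the mean of all the features. -/
def interClass (Cls : Finpartition (Finset.univ : Finset (Fin N)))
    (Z : Fin N → EuclideanSpace ℝ (Fin k)) : ℝ :=
  ∑ π ∈ Cls.parts, (π.card : ℝ) * ‖mean Z π - mean Z Finset.univ‖ ^ 2

/-- The K-means measure. -/
def kms (Cls : Finpartition (Finset.univ : Finset (Fin N)))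
    (Z : Fin N → EuclideanSpace ℝ (Fin k)) : ℝ :=
  intraClass Cls Z / interClass Cls Z

/-- The average similarity `𝔼_{i ∈ s} 𝔼_{j ∈ t} z_iᵀ z_j`. -/
def avgSim (Z : Fin N → EuclideanSpace ℝ (Fin k)) (s t : Finset (Fin N)) : ℝ :=
  (s.card : ℝ)⁻¹ * ∑ i ∈ s, (t.card : ℝ)⁻¹ * ∑ j ∈ t, inner ℝ (Z i) (Z j)

/-- The class-wise perturbation of a class `π` with connection `lπ` to the labeled data,
`(lπ - 1/N) - 2 (1 - |π|/N) (intra-class similarity - inter-class similarity)`. If `π` is the only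
class, the inter-class average is over the empty set, but its coefficient `1 - |π|/N` vanishes. -/
def classPert (Z : Fin N → EuclideanSpace ℝ (Fin k)) (lπ : ℝ) (π : Finset (Fin N)) : ℝ :=
  (lπ - 1 / N) - 2 * (1 - (π.card : ℝ) / N) * (avgSim Z π π - avgSim Z π πᶜ)

/-- The within-class scatter weighted by the connections,
`∑_{π ∈ Cls} l_π ∑_{i ∈ π} ‖z_i - μ_π‖²`. -/
def weightedScatter (Cls : Finpartition (Finset.univ : Finset (Fin N)))
    (Z : Fin N → EuclideanSpace ℝ (Fin k)) (lc : Finset (Fin N) → ℝ) : ℝ :=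
  ∑ π ∈ Cls.parts, lc π * ∑ i ∈ π, ‖Z i - mean Z π‖ ^ 2

end KMeans

end SORL

end

/-! The K-means measure depends on the features only through their Gram matrix `D^{-1/2} X
D^{-1/2}`, where `X` is the truncation of the normalized adjacency matrix to its top `k`
eigenvalues. The choice of eigenvectors, which need not be unique or depend continuously on `δ`,
therefore disappears once `X` is expanded to first order directly (`truncation_expansion`,
`EigenSystem.trunc_expansion`).

Write `L = diag 𝔩` and `W` for the normalized adjacency matrix at `δ = 0`. Since `D(0) = 1` and `∑ 𝔩
= 1`, that matrix moves in the direction `𝔩𝔩ᵀ - (LW + WL)/2`. In the eigenbasis of `W`, truncation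
keeps the top-top block of the direction, kills the bottom-bottom block and multiplies a mixed entry
by `λ_top / (λ_top - λ_bot)`. As `𝔩` lies in the top eigenspace, `𝔩𝔩ᵀ` sits in the top-top block and
survives unchanged. For the other term, a mixed coefficient differs from that of `(LX + XL)/2` by
`λ_top λ_bot / (λ_top - λ_bot)`, which is of the order of `1/𝒢`
(`EigenSystem.abs_truncDeriv_sub_le`). The two outer factors `D^{-1/2}` double the second term, so
the Gram matrix `G` has derivative `𝔩𝔩ᵀ - (LG + GL) + O(1/𝒢)`.

The two scatters are linear in the Gram matrix. Because `𝔩` is constant on classes, `𝔩𝔩ᵀ` has no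
intra-class scatter and `-(LG + GL)` contributes minus twice the weighted scatter; the inter-class
scatter produces exactly the sum of the `classPert`. The quotient rule gives the claimed main term
plus `η₁` times twice the weighted scatter, up to the gap error. This surplus is nonnegative, hence
droppable in part 1; in part 2 it dominates the gap error and leaves a strict first-order margin
that absorbs `O(δ²)`. -/

noncomputable section

namespace SORL

open Matrix Asymptotics

/-! ### First-order perturbation of spectral truncations, in the unperturbed eigenbasis. -/

section Truncation

variable {n : Type*} [Fintype n] [DecidableEq n]

lemma abs_entry_le_one_of_mul_transpose {S : Matrix n n ℝ} (hS : S * Sᵀ = 1) (i j : n) :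
    |S i j| ≤ 1 := by
  have h : ∑ m, S i m * S i m = 1 := by
    have := congrFun (congrFun hS i) i
    simpa [Matrix.mul_apply] using this
  have h1 : S i j * S i j ≤ 1 := by
    rw [← h]
    exact Finset.single_le_sum (f := fun m => S i m * S i m)
      (fun m _ => mul_self_nonneg _) (Finset.mem_univ j)
  exact abs_le_one_iff_mul_self_le_one.mpr h1

lemma mul_diagonal_mul_transpose_apply (S : Matrix n n ℝ) (w : n → ℝ) (i j : n) :
    (S * diagonal w * Sᵀ) i j = ∑ m, S i m * w m * S j m := by
  rw [Matrix.mul_apply]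
  simp only [Matrix.mul_diagonal, Matrix.transpose_apply]

/-- The first-order coefficient, in the eigenbasis of the unperturbed matrix with eigenvalues
`lam`, of the spectral truncation of a matrix perturbed in the direction `F'`. -/
def truncDeriv (top : n → Prop) [DecidablePred top] (lam : n → ℝ) (F' : Matrix n n ℝ) (i j : n) :
    ℝ :=
  if top i then if top j then F' i j else lam i / (lam i - lam j) * F' i j
  else if top j then lam j / (lam j - lam i) * F' i j else 0

/-- First-order perturbation of a spectral truncation, in the eigenbasis of the unperturbed
matrix. The columns of `S δ` are the eigenvectors of the perturbed matrix. -/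
theorem truncation_expansion (top : n → Prop) [DecidablePred top] (lam : n → ℝ)
    (mu : ℝ → n → ℝ) (S : ℝ → Matrix n n ℝ) (F' : Matrix n n ℝ) {c : ℝ} (hc : 0 < c)
    (hS : ∀ δ, S δ * (S δ)ᵀ = 1)
    (hF : ∀ i j, (fun δ => (S δ * diagonal (mu δ) * (S δ)ᵀ) i j - diagonal lam i j - δ * F' i j)
      =O[𝓝[>] (0 : ℝ)] fun δ => δ ^ 2)
    (hsep : ∀ᶠ δ in 𝓝[>] (0 : ℝ), ∀ i j, top i → ¬ top j →
      c ≤ lam i - mu δ j ∧ c ≤ mu δ i - lam j)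
    (hgap : ∀ i j, top i → ¬ top j → lam j < lam i) (i j : n) :
    (fun δ => (S δ * diagonal (fun m => if top m then mu δ m else 0) * (S δ)ᵀ) i j
        - diagonal (fun m => if top m then lam m else 0) i j
        - δ * truncDeriv top lam F' i j)
      =O[𝓝[>] (0 : ℝ)] fun δ => δ ^ 2 := by
  set l := 𝓝[>] (0 : ℝ) with hl
  set F : ℝ → Matrix n n ℝ := fun δ => S δ * diagonal (mu δ) * (S δ)ᵀ - diagonal lam with hFdef
  set X : ℝ → Matrix n n ℝ :=
    fun δ => S δ * diagonal (fun m => if top m then mu δ m else 0) * (S δ)ᵀ with hX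
  have hS' : ∀ δ, (S δ)ᵀ * S δ = 1 := fun δ => mul_eq_one_comm.mp (hS δ)
  have hid1 : (fun δ : ℝ => δ) =O[l] fun _ => (1 : ℝ) :=
    ((continuous_id.tendsto (0 : ℝ)).mono_left nhdsWithin_le_nhds).isBigO_one ℝ
  have hsq : (fun δ : ℝ => δ ^ 2) =O[l] fun δ => δ := by
    simpa [sq] using hid1.mul (isBigO_refl (fun δ : ℝ => δ) l)
  have hF1 : ∀ i j, (fun δ => F δ i j) =O[l] fun δ => δ := fun i j => by
    have h1 : (fun δ => F δ i j - δ * F' i j) =O[l] fun δ => δ ^ 2 := hF i j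
    have h2 : (fun δ : ℝ => δ * F' i j) =O[l] fun δ => δ := by
      simpa [mul_comm] using (isBigO_refl (fun δ : ℝ => δ) l).const_mul_left (F' i j)
    simpa using (h1.trans hsq).add h2
  have hS1 : ∀ i j, (fun δ => S δ i j) =O[l] fun _ => (1 : ℝ) := fun i j =>
    IsBigO.of_bound 1 (Eventually.of_forall fun δ => by
      simpa using abs_entry_le_one_of_mul_transpose (hS δ) i j)
  have hSmu : ∀ δ, S δ * diagonal (mu δ) = (F δ + diagonal lam) * S δ := fun δ => by
    simp only [hFdef, sub_add_cancel, Matrix.mul_assoc, hS' δ, Matrix.mul_one]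
  -- The eigenvalue equation, read entrywise in the unperturbed eigenbasis. Where `mu δ j - lam i`
  -- stays away from zero, that is on mixed pairs, it forces the overlap `S δ i j` to be `O(δ)`.
  have hov : ∀ i j, ∀ δ, (mu δ j - lam i) * S δ i j = ∑ m, F δ i m * S δ m j := fun i j δ => by
    have := congrFun (congrFun (hSmu δ) i) j
    rw [Matrix.mul_diagonal, Matrix.add_mul, Matrix.add_apply, Matrix.diagonal_mul,
      Matrix.mul_apply] at this
    linarith
  have hFS : ∀ i j, (fun δ => ∑ m, F δ i m * S δ m j) =O[l] fun δ => δ := fun i j => by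
    refine IsBigO.fun_sum fun m _ => ?_
    simpa using (hF1 i m).mul (hS1 m j)
  have hoff : ∀ i j, (top i ∧ ¬ top j ∨ ¬ top i ∧ top j) →
      (fun δ => S δ i j) =O[l] fun δ => δ := fun i j hij => by
    refine IsBigO.trans ?_ (hFS i j)
    refine IsBigO.of_bound c⁻¹ ?_
    filter_upwards [hsep] with δ hδ
    have habs : c ≤ |mu δ j - lam i| := by
      rcases hij with h | h
      · rw [abs_sub_comm]; exact ((hδ i j h.1 h.2).1).trans (le_abs_self _)
      · exact ((hδ j i h.2 h.1).2).trans (le_abs_self _)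
    rw [← hov i j δ, norm_mul, Real.norm_eq_abs, Real.norm_eq_abs, ← mul_assoc]
    have : 1 ≤ c⁻¹ * |mu δ j - lam i| := by
      rw [inv_mul_eq_div, le_div_iff₀ hc]; simpa using habs
    nlinarith [abs_nonneg (S δ i j)]
  -- Boundedness of the perturbed eigenvalues comes from writing them as Rayleigh quotients of unit
  -- columns of `S δ`.
  have hmu : ∀ j, (fun δ => mu δ j) =O[l] fun _ => (1 : ℝ) := fun j => by
    have h : ∀ δ, mu δ j = ∑ m, S δ m j * (lam m * S δ m j + ∑ p, F δ m p * S δ p j) := by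
      intro δ
      have h1 : ∑ m, S δ m j * S δ m j = 1 := by
        have := congrFun (congrFun (hS' δ) j) j
        simpa [Matrix.mul_apply] using this
      calc mu δ j = mu δ j * ∑ m, S δ m j * S δ m j := by rw [h1, mul_one]
        _ = _ := by
          rw [Finset.mul_sum]
          refine Finset.sum_congr rfl fun m _ => ?_
          rw [← hov m j δ]; ring
    simp_rw [h]
    refine IsBigO.fun_sum fun m _ => ?_
    have h2 : (fun δ => lam m * S δ m j + ∑ p, F δ m p * S δ p j) =O[l] fun _ => (1 : ℝ) :=
      ((hS1 m j).const_mul_left _).add ((hFS m j).trans hid1)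
    simpa using (hS1 m j).mul h2
  have hXe : ∀ δ i j, X δ i j = ∑ m, S δ i m * (if top m then mu δ m else 0) * S δ j m := by
    exact fun δ i j => mul_diagonal_mul_transpose_apply _ _ i j
  -- The complementary form of `X`, with a sum over the discarded eigenvalues only. In the top-top
  -- block each of its terms has two mixed overlaps, hence is `O(δ²)`; in the bottom-bottom block
  -- the direct form `hXe` plays that role.
  have hXFe : ∀ δ i j, X δ i j = F δ i j + diagonal lam i j
      - ∑ m, S δ i m * (if top m then 0 else mu δ m) * S δ j m := by
    intro δ i j
    rw [hXe]
    simp only [hFdef, Matrix.sub_apply, sub_add_cancel, mul_diagonal_mul_transpose_apply]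
    rw [← Finset.sum_sub_distrib]
    refine Finset.sum_congr rfl fun m _ => ?_
    split_ifs <;> ring
  have hbb : ∀ i j, ¬ top i → ¬ top j → (fun δ => X δ i j) =O[l] fun δ => δ ^ 2 := by
    intro i j hi hj
    simp_rw [hXe]
    refine IsBigO.fun_sum fun m _ => ?_
    by_cases hm : top m
    · simp only [hm, if_true]
      have := ((hoff i m (Or.inr ⟨hi, hm⟩)).mul (hmu m)).mul (hoff j m (Or.inr ⟨hj, hm⟩))
      simpa [sq] using this
    · simpa [hm] using isBigO_zero _ _
  have htt : ∀ i j, top i → top j →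
      (fun δ => X δ i j - (F δ i j + diagonal lam i j)) =O[l] fun δ => δ ^ 2 := by
    intro i j hi hj
    simp_rw [hXFe, sub_sub_cancel_left]
    refine IsBigO.neg_left (IsBigO.fun_sum fun m _ => ?_)
    by_cases hm : top m
    · simpa [hm] using isBigO_zero _ _
    · simp only [hm, if_false]
      have := ((hoff i m (Or.inl ⟨hi, hm⟩)).mul (hmu m)).mul (hoff j m (Or.inl ⟨hj, hm⟩))
      simpa [sq] using this
  have hX1 : ∀ i j, (fun δ => X δ i j - diagonal (fun m => if top m then lam m else 0) i j)
      =O[l] fun δ => δ := by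
    intro i j
    by_cases hi : top i <;> by_cases hj : top j
    · have := ((htt i j hi hj).trans hsq).add (hF1 i j)
      refine this.congr_left fun δ => ?_
      by_cases hij : i = j
      · subst hij; simp only [hi, diagonal_apply_eq, if_true]; ring
      · simp only [diagonal_apply_ne _ hij]; ring
    · have hij : i ≠ j := fun h => hj (h ▸ hi)
      simp only [Matrix.diagonal_apply_ne _ hij, sub_zero]
      simp_rw [hXe]
      refine IsBigO.fun_sum fun m _ => ?_
      by_cases hm : top m
      · simp only [hm, if_true]
        simpa using ((hS1 i m).mul (hmu m)).mul (hoff j m (Or.inr ⟨hj, hm⟩))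
      · simpa [hm] using isBigO_zero _ _
    · have hij : i ≠ j := fun h => hi (h ▸ hj)
      simp only [Matrix.diagonal_apply_ne _ hij, sub_zero]
      simp_rw [hXe]
      refine IsBigO.fun_sum fun m _ => ?_
      by_cases hm : top m
      · simp only [hm, if_true]
        simpa using ((hoff i m (Or.inr ⟨hi, hm⟩)).mul (hmu m)).mul (hS1 j m)
      · simpa [hm] using isBigO_zero _ _
    · refine ((hbb i j hi hj).trans hsq).congr_left fun δ => ?_
      by_cases hij : i = j
      · subst hij; simp [hi]
      · simp [hij]
  -- Mixed entries contain only one small overlap, so direct estimation stops at `O(δ)`. The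
  -- truncation commutes with the full matrix, and this determines them: `(lam i - lam j) X_ij = (XF
  -- - FX)_ij`, where `X` may be replaced by its value at zero at the cost of `O(δ²)`.
  have hcomm : ∀ δ, X δ * (F δ + diagonal lam) = (F δ + diagonal lam) * X δ := by
    intro δ
    have h1 : F δ + diagonal lam = S δ * diagonal (mu δ) * (S δ)ᵀ := by simp [hFdef]
    rw [h1]
    calc S δ * diagonal (fun m => if top m then mu δ m else 0) * (S δ)ᵀ
          * (S δ * diagonal (mu δ) * (S δ)ᵀ)
        = S δ * (diagonal (fun m => if top m then mu δ m else 0) * ((S δ)ᵀ * S δ)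
            * diagonal (mu δ)) * (S δ)ᵀ := by simp only [Matrix.mul_assoc]
      _ = S δ * (diagonal (mu δ) * ((S δ)ᵀ * S δ)
            * diagonal (fun m => if top m then mu δ m else 0)) * (S δ)ᵀ := by
          rw [hS' δ, Matrix.mul_one, Matrix.mul_one, diagonal_mul_diagonal, diagonal_mul_diagonal]
          simp only [mul_comm]
      _ = _ := by simp only [hX, Matrix.mul_assoc]
  have hcross : ∀ i j, i ≠ j → ∀ δ, (lam i - lam j) * X δ i j
      = ∑ m, X δ i m * F δ m j - ∑ m, F δ i m * X δ m j := by
    intro i j _ δ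
    have := congrFun (congrFun (hcomm δ) i) j
    rw [Matrix.mul_add, Matrix.add_mul, Matrix.add_apply, Matrix.add_apply, Matrix.mul_diagonal,
      Matrix.diagonal_mul, Matrix.mul_apply, Matrix.mul_apply] at this
    linarith
  have hcross2 : ∀ i j, (fun δ => (∑ m, X δ i m * F δ m j - ∑ m, F δ i m * X δ m j)
      - ((if top i then lam i else 0) - (if top j then lam j else 0)) * F δ i j)
      =O[l] fun δ => δ ^ 2 := by
    intro i j
    have h1 : (fun δ => ∑ m, (X δ i m - diagonal (fun m => if top m then lam m else 0) i m)
        * F δ m j) =O[l] fun δ => δ ^ 2 :=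
      IsBigO.fun_sum fun m _ => by simpa [sq] using (hX1 i m).mul (hF1 m j)
    have h2 : (fun δ => ∑ m, F δ i m * (X δ m j - diagonal (fun m => if top m then lam m else 0)
        m j)) =O[l] fun δ => δ ^ 2 :=
      IsBigO.fun_sum fun m _ => by simpa [sq] using (hF1 i m).mul (hX1 m j)
    refine (h1.sub h2).congr_left fun δ => ?_
    simp only [sub_mul, mul_sub, Finset.sum_sub_distrib]
    have e1 : ∑ m, diagonal (fun m => if top m then lam m else 0) i m * F δ m j
        = (if top i then lam i else 0) * F δ i j := by
      rw [← Matrix.mul_apply, Matrix.diagonal_mul]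
    have e2 : ∑ m, F δ i m * diagonal (fun m => if top m then lam m else 0) m j
        = F δ i j * (if top j then lam j else 0) := by
      rw [← Matrix.mul_apply, Matrix.mul_diagonal]
    rw [e1, e2]; ring
  have hcross3 : ∀ i j, i ≠ j → lam i - lam j ≠ 0 → (fun δ => X δ i j - δ *
      (((if top i then lam i else 0) - (if top j then lam j else 0)) / (lam i - lam j) * F' i j))
      =O[l] fun δ => δ ^ 2 := by
    intro i j hij hne
    have h3 := ((hF i j).const_mul_left
      (((if top i then lam i else 0) - (if top j then lam j else 0)) / (lam i - lam j))).add
      ((hcross2 i j).const_mul_left (lam i - lam j)⁻¹)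
    refine h3.congr_left fun δ => ?_
    rw [← hcross i j hij δ]
    have : (S δ * diagonal (mu δ) * (S δ)ᵀ) i j - diagonal lam i j = F δ i j := rfl
    rw [this]
    field_simp
    ring
  unfold truncDeriv
  by_cases hi : top i <;> by_cases hj : top j
  · have := (htt i j hi hj).add (hF i j)
    refine this.congr_left fun δ => ?_
    have h4 : (S δ * diagonal (mu δ) * (S δ)ᵀ) i j - diagonal lam i j = F δ i j := rfl
    rw [h4]
    by_cases hij : i = j
    · subst hij; simp only [hi, diagonal_apply_eq, if_true]; ring
    · simp only [diagonal_apply_ne _ hij, hi, hj, if_true]; ring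
  · have hij : i ≠ j := fun h => hj (h ▸ hi)
    have h := hcross3 i j hij (by linarith [hgap i j hi hj])
    simpa [hi, hj, hij] using h
  · have hij : i ≠ j := fun h => hi (h ▸ hj)
    have h := hcross3 i j hij (by have := hgap j i hj hi; intro h; linarith)
    refine h.congr_left fun δ => ?_
    simp only [hi, hj, diagonal_apply_ne _ hij, if_true, if_false]
    rw [show lam j / (lam j - lam i) = (0 - lam j) / (lam i - lam j) by
      rw [← neg_sub (lam i), div_neg, zero_sub, neg_div]]
    ring
  · refine (hbb i j hi hj).congr_left fun δ => ?_
    by_cases hij : i = j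
    · subst hij; simp [hi, hX]
    · simp [hij, hi, hj, hX]

end Truncation

/-! ### Ordered eigensystems: Weyl's inequality, truncation, and the effect of the gap. -/

section EigenSystem

variable {N : ℕ} {M : Matrix (Fin N) (Fin N) ℝ}

/-- The orthogonal matrix whose columns are the eigenvectors. -/
def EigenSystem.mat (E : EigenSystem M) : Matrix (Fin N) (Fin N) ℝ :=
  Matrix.of fun x j => E.vec j x

lemma EigenSystem.transpose_mat_mul_mat (E : EigenSystem M) : E.matᵀ * E.mat = 1 := by
  ext i j
  have h := orthonormal_iff_ite.mp E.vec.orthonormal i j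
  rw [PiLp.inner_apply] at h
  simp only [Matrix.mul_apply, Matrix.transpose_apply, EigenSystem.mat, Matrix.of_apply,
    Matrix.one_apply]
  rw [← h]
  exact Finset.sum_congr rfl fun x _ => by simp [mul_comm]

lemma EigenSystem.mat_mul_transpose_mat (E : EigenSystem M) : E.mat * E.matᵀ = 1 :=
  mul_eq_one_comm.mp E.transpose_mat_mul_mat

lemma EigenSystem.mul_mat (E : EigenSystem M) : M * E.mat = E.mat * diagonal E.val := by
  ext x j
  rw [Matrix.mul_diagonal, Matrix.mul_apply]
  have := E.mulVec_vec j x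
  simp only [Matrix.mulVec, dotProduct] at this
  simp only [EigenSystem.mat, Matrix.of_apply]
  rw [this, mul_comm]

lemma EigenSystem.eq_mat_mul (E : EigenSystem M) : M = E.mat * diagonal E.val * E.matᵀ := by
  rw [← E.mul_mat, Matrix.mul_assoc, E.mat_mul_transpose_mat, Matrix.mul_one]

/-- The spectral truncation keeping the top `k` eigenvalues. -/
def EigenSystem.trunc (E : EigenSystem M) (k : ℕ) : Matrix (Fin N) (Fin N) ℝ :=
  E.mat * diagonal (fun j : Fin N => if (j : ℕ) < k then E.val j else 0) * E.matᵀ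

lemma EigenSystem.abs_mat_le_one (E : EigenSystem M) (x j : Fin N) : |E.mat x j| ≤ 1 :=
  abs_entry_le_one_of_mul_transpose E.mat_mul_transpose_mat x j

lemma EigenSystem.dotProduct_mulVec_mat (E : EigenSystem M) (c : Fin N → ℝ) :
    (E.mat *ᵥ c) ⬝ᵥ (M *ᵥ (E.mat *ᵥ c)) = ∑ j, E.val j * c j ^ 2 := by
  rw [Matrix.mulVec_mulVec, E.mul_mat, ← Matrix.mulVec_mulVec, Matrix.dotProduct_mulVec,
    Matrix.vecMul_mulVec, E.transpose_mat_mul_mat, Matrix.vecMul_one]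
  simp only [dotProduct, Matrix.mulVec_diagonal]
  exact Finset.sum_congr rfl fun j _ => by ring

lemma EigenSystem.dotProduct_mat (E : EigenSystem M) (c : Fin N → ℝ) :
    (E.mat *ᵥ c) ⬝ᵥ (E.mat *ᵥ c) = ∑ j, c j ^ 2 := by
  rw [Matrix.dotProduct_mulVec, Matrix.vecMul_mulVec, E.transpose_mat_mul_mat, Matrix.vecMul_one]
  simp only [dotProduct, sq]

lemma EigenSystem.val_eq (E : EigenSystem M) (j : Fin N) :
    E.val j = (fun x => E.mat x j) ⬝ᵥ (M *ᵥ fun x => E.mat x j) := by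
  have h := E.dotProduct_mulVec_mat (Pi.single j 1)
  rw [Matrix.mulVec_single_one] at h
  refine Eq.trans ?_ h.symm
  rw [Finset.sum_eq_single j]
  · simp
  · intro b _ hb; simp [hb]
  · simp

lemma EigenSystem.sum_mat_sq (E : EigenSystem M) (j : Fin N) : ∑ x, E.mat x j ^ 2 = 1 := by
  have := congrFun (congrFun E.transpose_mat_mul_mat j) j
  simpa [Matrix.mul_apply, sq] using this

/-- Weyl's inequality. -/
theorem EigenSystem.val_le_val_add {A B : Matrix (Fin N) (Fin N) ℝ} (E : EigenSystem A)
    (F : EigenSystem B) {ε : ℝ} (h : ∀ w : Fin N → ℝ, w ⬝ᵥ (B *ᵥ w) ≤ w ⬝ᵥ (A *ᵥ w) + ε * (w ⬝ᵥ w))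
    (i : Fin N) : F.val i ≤ E.val i + ε := by
  let G : Matrix (Fin N) (Fin N) ℝ := E.matᵀ * F.mat
  -- A dimension count as a determinant: row `i` is zero, so `H` has a nonzero kernel vector `c`.
  -- The rows below `i` make `F.mat *ᵥ c` orthogonal to the eigenvectors of `A` of index `< i`; the
  -- rows above `i` place it in the span of the eigenvectors of `B` of index `≤ i`. Both Rayleigh
  -- quotients are then controlled by the `i`-th eigenvalues.
  let H : Matrix (Fin N) (Fin N) ℝ :=
    Matrix.of fun m j => if m < i then G m j else if m = i then 0 else if m = j then 1 else 0
  obtain ⟨c, hc0, hc⟩ := Matrix.exists_mulVec_eq_zero_iff.mpr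
    (Matrix.det_eq_zero_of_row_eq_zero (A := H) i fun j => by simp [H])
  have hlow : ∀ m, m < i → (G *ᵥ c) m = 0 := fun m hm => by
    have := congrFun hc m
    simpa [H, Matrix.mulVec, dotProduct, hm] using this
  have hhigh : ∀ m, i < m → c m = 0 := fun m hm => by
    have := congrFun hc m
    simpa [H, Matrix.mulVec, dotProduct, hm.not_gt, hm.ne'] using this
  have hw : E.mat *ᵥ (G *ᵥ c) = F.mat *ᵥ c := by
    rw [Matrix.mulVec_mulVec, ← Matrix.mul_assoc, E.mat_mul_transpose_mat, Matrix.one_mul]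
  have hpos : 0 < ∑ j, c j ^ 2 := by
    obtain ⟨j, hj⟩ := Function.ne_iff.mp hc0
    exact Finset.sum_pos' (fun _ _ => sq_nonneg _) ⟨j, Finset.mem_univ _, sq_pos_of_ne_zero hj⟩
  have hB : F.val i * ∑ j, c j ^ 2 ≤ ∑ j, F.val j * c j ^ 2 := by
    rw [Finset.mul_sum]
    refine Finset.sum_le_sum fun j _ => ?_
    rcases le_or_gt j i with hj | hj
    · exact mul_le_mul_of_nonneg_right (F.antitone_val hj) (sq_nonneg _)
    · simp [hhigh j hj]
  have hA : ∑ j, E.val j * (G *ᵥ c) j ^ 2 ≤ E.val i * ∑ j, (G *ᵥ c) j ^ 2 := by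
    rw [Finset.mul_sum]
    refine Finset.sum_le_sum fun j _ => ?_
    rcases lt_or_ge j i with hj | hj
    · simp [hlow j hj]
    · exact mul_le_mul_of_nonneg_right (E.antitone_val hj) (sq_nonneg _)
  have hnorm : ∑ j, (G *ᵥ c) j ^ 2 = ∑ j, c j ^ 2 := by
    rw [← E.dotProduct_mat, hw, F.dotProduct_mat]
  have hmain := h (F.mat *ᵥ c)
  rw [F.dotProduct_mulVec_mat, F.dotProduct_mat, ← hw, E.dotProduct_mulVec_mat] at hmain
  rw [hnorm] at hA
  refine le_of_mul_le_mul_right ?_ hpos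
  rw [add_mul]
  linarith

lemma dotProduct_mulVec_le_sum_abs (A : Matrix (Fin N) (Fin N) ℝ) (w : Fin N → ℝ) :
    w ⬝ᵥ (A *ᵥ w) ≤ (∑ x, ∑ y, |A x y|) * (w ⬝ᵥ w) := by
  have hle : ∀ x, w x * w x ≤ ∑ z, w z * w z := fun x =>
    Finset.single_le_sum (f := fun z => w z * w z) (fun _ _ => mul_self_nonneg _)
      (Finset.mem_univ x)
  have key : ∀ x y, w x * (A x y * w y) ≤ |A x y| * ∑ z, w z * w z := by
    intro x y
    have h1 : |w x * w y| ≤ ∑ z, w z * w z := by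
      rw [abs_le]
      constructor <;> nlinarith [hle x, hle y, sq_nonneg (w x + w y), sq_nonneg (w x - w y)]
    calc w x * (A x y * w y) = A x y * (w x * w y) := by ring
      _ ≤ |A x y * (w x * w y)| := le_abs_self _
      _ = |A x y| * |w x * w y| := abs_mul _ _
      _ ≤ _ := mul_le_mul_of_nonneg_left h1 (abs_nonneg _)
  calc w ⬝ᵥ (A *ᵥ w) = ∑ x, ∑ y, w x * (A x y * w y) := by
        simp only [dotProduct, Matrix.mulVec, Finset.mul_sum]
    _ ≤ ∑ x, ∑ y, |A x y| * ∑ z, w z * w z :=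
        Finset.sum_le_sum fun x _ => Finset.sum_le_sum fun y _ => key x y
    _ = _ := by simp only [← Finset.sum_mul, dotProduct]

lemma isBigO_conj_apply {l : Filter ℝ} {C : ℝ → Matrix (Fin N) (Fin N) ℝ} {g : ℝ → ℝ}
    (hC : ∀ x y, (fun δ => C δ x y) =O[l] g) (L R : Matrix (Fin N) (Fin N) ℝ) (i j : Fin N) :
    (fun δ => (L * C δ * R) i j) =O[l] g := by
  simp only [Matrix.mul_apply, Finset.sum_mul]
  refine IsBigO.fun_sum fun y _ => IsBigO.fun_sum fun x _ => ?_
  refine ((hC x y).const_mul_left (L i x * R y j)).congr_left fun δ => ?_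
  ring

lemma abs_conj_apply_le {D U : Matrix (Fin N) (Fin N) ℝ} {r : ℝ} (hU : ∀ x j, |U x j| ≤ 1)
    (hD : ∀ i j, |D i j| ≤ r) (x y : Fin N) : |(U * D * Uᵀ) x y| ≤ (N : ℝ) ^ 2 * r := by
  simp only [Matrix.mul_apply, Finset.sum_mul, Matrix.transpose_apply]
  have hterm : ∀ i j, |U x i * D i j * U y j| ≤ r := fun i j => by
    rw [abs_mul, abs_mul]
    have h0 : 0 ≤ r := (abs_nonneg _).trans (hD i j)
    calc |U x i| * |D i j| * |U y j| ≤ 1 * r * 1 := by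
          gcongr
          · exact hU x i
          · exact hD i j
          · exact hU y j
      _ = r := by ring
  calc _ ≤ ∑ j, |∑ i, U x i * D i j * U y j| := Finset.abs_sum_le_sum_abs _ _
    _ ≤ ∑ j : Fin N, ∑ i : Fin N, r := Finset.sum_le_sum fun j _ =>
        (Finset.abs_sum_le_sum_abs _ _).trans (Finset.sum_le_sum fun i _ => hterm i j)
    _ = _ := by simp; ring

/-- First-order perturbation of the truncation to the top `k` eigenvalues. -/
theorem EigenSystem.trunc_expansion {A : ℝ → Matrix (Fin N) (Fin N) ℝ}
    (E : ∀ δ, EigenSystem (A δ)) (k : ℕ) (A' : Matrix (Fin N) (Fin N) ℝ)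
    (hA : ∀ x y, (fun δ => A δ x y - A 0 x y - δ * A' x y) =O[𝓝[>] (0 : ℝ)] fun δ => δ ^ 2)
    {γ : ℝ} (hγ : 0 < γ)
    (hgap : ∀ i j : Fin N, (i : ℕ) < k → ¬ (j : ℕ) < k → (E 0).val j + γ ≤ (E 0).val i)
    (x y : Fin N) :
    (fun δ => (E δ).trunc k x y - (E 0).trunc k x y
        - δ * ((E 0).mat * Matrix.of (truncDeriv (fun j : Fin N => (j : ℕ) < k) (E 0).val
            ((E 0).matᵀ * A' * (E 0).mat)) * (E 0).matᵀ) x y)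
      =O[𝓝[>] (0 : ℝ)] fun δ => δ ^ 2 := by
  set U := (E 0).mat with hU
  have hUU : U * Uᵀ = 1 := (E 0).mat_mul_transpose_mat
  have hUU' : Uᵀ * U = 1 := (E 0).transpose_mat_mul_mat
  have hid : Tendsto (fun δ : ℝ => δ) (𝓝[>] 0) (𝓝 0) :=
    (continuous_id.tendsto (0 : ℝ)).mono_left nhdsWithin_le_nhds
  have hA0 : ∀ x y, Tendsto (fun δ => |A δ x y - A 0 x y|) (𝓝[>] 0) (𝓝 0) := fun x y => by
    have h1 : Tendsto (fun δ => A δ x y - A 0 x y - δ * A' x y) (𝓝[>] 0) (𝓝 0) :=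
      (hA x y).trans_tendsto (by simpa using hid.pow 2)
    have h2 := (h1.add (hid.mul_const (A' x y))).abs
    simpa using h2
  have hε : Tendsto (fun δ => ∑ x, ∑ y, |A δ x y - A 0 x y|) (𝓝[>] 0) (𝓝 0) := by
    simpa using tendsto_finsetSum Finset.univ fun x _ =>
      tendsto_finsetSum Finset.univ fun y _ => hA0 x y
  -- By Weyl's inequality the eigenvalues move by at most `γ / 2` for small `δ`, so half of the gap
  -- `γ` is left as separation. The overlap matrix is `Uᵀ * (E δ).mat`.
  have key := truncation_expansion (fun j : Fin N => (j : ℕ) < k) (E 0).val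
    (fun δ => (E δ).val) (fun δ => Uᵀ * (E δ).mat) (Uᵀ * A' * U) (c := γ / 2) (by linarith)
    (fun δ => by
      rw [Matrix.transpose_mul, Matrix.transpose_transpose, Matrix.mul_assoc,
        ← Matrix.mul_assoc (E δ).mat, (E δ).mat_mul_transpose_mat, Matrix.one_mul, hUU'])
    (fun i j => by
      have h := isBigO_conj_apply (C := fun δ => A δ - A 0 - δ • A') (l := 𝓝[>] 0)
        (g := fun δ => δ ^ 2) (fun x y => by simpa using hA x y) Uᵀ U i j
      refine h.congr_left fun δ => ?_
      have e1 : Uᵀ * (E δ).mat * diagonal (E δ).val * (Uᵀ * (E δ).mat)ᵀ = Uᵀ * A δ * U := by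
        conv_rhs => rw [(E δ).eq_mat_mul]
        simp only [Matrix.transpose_mul, Matrix.transpose_transpose, Matrix.mul_assoc]
      have e2 : diagonal (E 0).val = Uᵀ * A 0 * U := by
        rw [Matrix.mul_assoc, (E 0).mul_mat, ← hU, ← Matrix.mul_assoc, hUU', Matrix.one_mul]
      rw [e1, e2]
      simp [Matrix.mul_sub, Matrix.sub_mul])
    (by
      filter_upwards [hε.eventually (ge_mem_nhds (show (0 : ℝ) < γ / 2 by linarith))]
        with δ hδ i j hi hj
      have h1 : ∀ m, (E δ).val m ≤ (E 0).val m + ∑ x, ∑ y, |A δ x y - A 0 x y| :=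
        (E 0).val_le_val_add (E δ) fun w => by
          have := dotProduct_mulVec_le_sum_abs (A δ - A 0) w
          rw [Matrix.sub_mulVec, dotProduct_sub] at this
          simp only [Matrix.sub_apply] at this
          linarith
      have h2 : ∀ m, (E 0).val m ≤ (E δ).val m + ∑ x, ∑ y, |A δ x y - A 0 x y| :=
        (E δ).val_le_val_add (E 0) fun w => by
          have := dotProduct_mulVec_le_sum_abs (A 0 - A δ) w
          rw [Matrix.sub_mulVec, dotProduct_sub] at this
          simp only [Matrix.sub_apply, abs_sub_comm (A 0 _ _)] at this
          linarith
      have h3 := hgap i j hi hj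
      constructor
      · linarith [h1 j]
      · linarith [h2 i])
    (fun i j hi hj => by linarith [hgap i j hi hj])
  have h := isBigO_conj_apply (C := fun δ =>
    Uᵀ * (E δ).mat * diagonal (fun m : Fin N => if (m : ℕ) < k then (E δ).val m else 0)
        * (Uᵀ * (E δ).mat)ᵀ
      - diagonal (fun m : Fin N => if (m : ℕ) < k then (E 0).val m else 0)
      - δ • Matrix.of (truncDeriv (fun j : Fin N => (j : ℕ) < k) (E 0).val (Uᵀ * A' * U)))
    (l := 𝓝[>] 0) (g := fun δ => δ ^ 2) (fun i j => by simpa using key i j) U Uᵀ x y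
  refine h.congr_left fun δ => ?_
  have e1 : U * (Uᵀ * (E δ).mat * diagonal (fun m : Fin N => if (m : ℕ) < k then (E δ).val m else 0)
      * (Uᵀ * (E δ).mat)ᵀ) * Uᵀ = (E δ).trunc k := by
    rw [EigenSystem.trunc, Matrix.transpose_mul, Matrix.transpose_transpose]
    calc _ = (U * Uᵀ) * ((E δ).mat
          * diagonal (fun m : Fin N => if (m : ℕ) < k then (E δ).val m else 0) * (E δ).matᵀ)
          * (U * Uᵀ) := by simp only [Matrix.mul_assoc]
      _ = _ := by rw [hUU, Matrix.one_mul, Matrix.mul_one]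
  simp only [Matrix.mul_sub, Matrix.sub_mul, Matrix.sub_apply, e1, Matrix.mul_smul,
    Matrix.smul_mul, Matrix.smul_apply, smul_eq_mul]
  rfl

/-- When the perturbation direction is `𝔩𝔩ᵀ - (L W + W L) / 2` with `L = diag 𝔩` and `𝔩` in the span
of the top eigenvectors of `W`, the derivative of the truncation `X` is
`𝔩𝔩ᵀ - (L X + X L) / 2` up to an error proportional to the reciprocal spectral gap. -/
theorem EigenSystem.abs_truncDeriv_sub_le (E : EigenSystem M) (k : ℕ) (v : Fin N → ℝ) {g : ℝ}
    (hv1 : ∀ x, |v x| ≤ 1) (hv : ∀ j : Fin N, ¬ (j : ℕ) < k → (E.matᵀ *ᵥ v) j = 0)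
    (hg : g ≤ 1 / 2) (hg0 : 0 ≤ g) (hnn : ∀ j, 0 ≤ E.val j) (hle : ∀ j, E.val j ≤ 1)
    (hgap : ∀ i j : Fin N, (i : ℕ) < k → ¬ (j : ℕ) < k → 0 < E.val i ∧ E.val j ≤ g * E.val i)
    (x y : Fin N) :
    |(E.mat * Matrix.of (truncDeriv (fun j : Fin N => (j : ℕ) < k) E.val
            (E.matᵀ * (vecMulVec v v - (1 / 2 : ℝ) • (diagonal v * M + M * diagonal v)) * E.mat))
          * E.matᵀ) x y
        - (v x * v y - (v x + v y) / 2 * E.trunc k x y)| ≤ (N : ℝ) ^ 2 * (2 * N * g) := by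
  set U := E.mat with hU
  have hUU : U * Uᵀ = 1 := E.mat_mul_transpose_mat
  have hUU' : Uᵀ * U = 1 := E.transpose_mat_mul_mat
  set L := Uᵀ * diagonal v * U with hL
  set T := vecMulVec v v - (1 / 2 : ℝ) • (diagonal v * E.trunc k + E.trunc k * diagonal v) with hT
  have hTxy : T x y = v x * v y - (v x + v y) / 2 * E.trunc k x y := by
    simp only [hT, Matrix.sub_apply, vecMulVec_apply, Matrix.smul_apply, Matrix.add_apply,
      Matrix.diagonal_mul, Matrix.mul_diagonal, smul_eq_mul]
    ring
  -- Stated for an arbitrary spectrum `w` so as to serve both `M` and its truncation, which share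
  -- the eigenbasis.
  have hconj : ∀ w : Fin N → ℝ, ∀ i j,
      (Uᵀ * (vecMulVec v v - (1 / 2 : ℝ) • (diagonal v * (U * diagonal w * Uᵀ)
        + U * diagonal w * Uᵀ * diagonal v)) * U) i j
      = (Uᵀ *ᵥ v) i * (Uᵀ *ᵥ v) j - (w i + w j) / 2 * L i j := by
    intro w i j
    have e1 : Uᵀ * (diagonal v * (U * diagonal w * Uᵀ)) * U = L * diagonal w := by
      calc _ = Uᵀ * diagonal v * U * diagonal w * (Uᵀ * U) := by simp only [Matrix.mul_assoc]
        _ = _ := by rw [hUU', Matrix.mul_one]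
    have e2 : Uᵀ * (U * diagonal w * Uᵀ * diagonal v) * U = diagonal w * L := by
      calc _ = (Uᵀ * U) * diagonal w * (Uᵀ * diagonal v * U) := by simp only [Matrix.mul_assoc]
        _ = _ := by rw [hUU', Matrix.one_mul]
    have e3 : Uᵀ * vecMulVec v v * U = vecMulVec (Uᵀ *ᵥ v) (Uᵀ *ᵥ v) := by
      rw [Matrix.mul_vecMulVec, Matrix.vecMulVec_mul, ← Matrix.mulVec_transpose]
    rw [Matrix.mul_sub, Matrix.sub_mul, e3, Matrix.mul_smul, Matrix.smul_mul, Matrix.mul_add,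
      Matrix.add_mul, e1, e2]
    simp only [Matrix.sub_apply, vecMulVec_apply, Matrix.smul_apply, Matrix.add_apply,
      Matrix.diagonal_mul, Matrix.mul_diagonal, smul_eq_mul]
    ring
  have hM : ∀ i j, (Uᵀ * (vecMulVec v v - (1 / 2 : ℝ) • (diagonal v * M + M * diagonal v)) * U) i j
      = (Uᵀ *ᵥ v) i * (Uᵀ *ᵥ v) j - (E.val i + E.val j) / 2 * L i j := by
    have h := hconj E.val
    rwa [← E.eq_mat_mul] at h
  have hTc : ∀ i j, (Uᵀ * T * U) i j = (Uᵀ *ᵥ v) i * (Uᵀ *ᵥ v) j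
      - ((if (i : ℕ) < k then E.val i else 0) + (if (j : ℕ) < k then E.val j else 0)) / 2
        * L i j := hconj _
  have hLb : ∀ i j, |L i j| ≤ N := fun i j => by
    have : L i j = ∑ z, U z i * v z * U z j := by
      rw [hL, Matrix.mul_apply]
      simp only [Matrix.mul_diagonal, Matrix.transpose_apply]
    rw [this]
    refine (Finset.abs_sum_le_sum_abs _ _).trans ?_
    calc ∑ z, |U z i * v z * U z j| ≤ ∑ _z : Fin N, (1 : ℝ) := Finset.sum_le_sum fun z _ => by
          rw [abs_mul, abs_mul]
          exact mul_le_one₀ (mul_le_one₀ (E.abs_mat_le_one z i) (abs_nonneg _) (hv1 z))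
            (abs_nonneg _) (E.abs_mat_le_one z j)
      _ = N := by simp
  -- The difference equals `-λᵢ λⱼ / (λᵢ - λⱼ)`. Here `λⱼ ≤ g λᵢ` and `λᵢ ≤ 1` bound the numerator
  -- by `g λᵢ`, while `g ≤ 1/2` gives the denominator at least `λᵢ / 2`.
  have hcoef : ∀ i j : Fin N, (i : ℕ) < k → ¬ (j : ℕ) < k →
      |E.val i / (E.val i - E.val j) * (-((E.val i + E.val j) / 2)) - -(E.val i / 2)| ≤ 2 * g := by
    intro i j hi hj
    obtain ⟨hpos, hlt⟩ := hgap i j hi hj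
    have hd : E.val i / 2 ≤ E.val i - E.val j := by nlinarith
    have hd0 : 0 < E.val i - E.val j := by linarith
    have e : E.val i / (E.val i - E.val j) * (-((E.val i + E.val j) / 2)) - -(E.val i / 2)
        = -(E.val i * E.val j / (E.val i - E.val j)) := by
      field_simp; ring
    rw [e, abs_neg, abs_of_nonneg (div_nonneg (mul_nonneg hpos.le (hnn j)) hd0.le),
      div_le_iff₀ hd0]
    have h1 : E.val i * E.val j ≤ g * E.val i := by
      nlinarith [hle i, hnn j]
    nlinarith
  have hdiff : ∀ i j, |(Matrix.of (truncDeriv (fun j : Fin N => (j : ℕ) < k) E.val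
      (Uᵀ * (vecMulVec v v - (1 / 2 : ℝ) • (diagonal v * M + M * diagonal v)) * U))
        - Uᵀ * T * U) i j| ≤ 2 * N * g := by
    have h0 : 0 ≤ 2 * N * g := by positivity
    intro i j
    simp only [Matrix.sub_apply, Matrix.of_apply, truncDeriv, hM, hTc]
    by_cases hi : (i : ℕ) < k <;> by_cases hj : (j : ℕ) < k
    · simpa [hi, hj] using h0
    · simp only [hi, hj, if_true, if_false, hv j hj]
      rw [show E.val i / (E.val i - E.val j) * ((Uᵀ *ᵥ v) i * 0 - (E.val i + E.val j) / 2 * L i j)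
          - ((Uᵀ *ᵥ v) i * 0 - (E.val i + 0) / 2 * L i j)
        = (E.val i / (E.val i - E.val j) * (-((E.val i + E.val j) / 2)) - -(E.val i / 2))
          * L i j by ring, abs_mul]
      calc _ ≤ 2 * g * N := mul_le_mul (hcoef i j hi hj) (hLb i j) (abs_nonneg _) (by linarith)
        _ = _ := by ring
    · simp only [hi, hj, if_true, if_false, hv i hi]
      rw [show E.val j / (E.val j - E.val i) * (0 * (Uᵀ *ᵥ v) j - (E.val i + E.val j) / 2 * L i j)
          - (0 * (Uᵀ *ᵥ v) j - (0 + E.val j) / 2 * L i j)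
        = (E.val j / (E.val j - E.val i) * (-((E.val j + E.val i) / 2)) - -(E.val j / 2))
          * L i j by ring, abs_mul]
      calc _ ≤ 2 * g * N := mul_le_mul (hcoef j i hj hi) (hLb i j) (abs_nonneg _) (by linarith)
        _ = _ := by ring
    · simpa [hi, hj, hv i hi] using h0
  have hfin := abs_conj_apply_le (U := U) E.abs_mat_le_one hdiff x y
  have e : U * (Uᵀ * T * U) * Uᵀ = T := by
    calc _ = (U * Uᵀ) * T * (U * Uᵀ) := by simp only [Matrix.mul_assoc]
      _ = T := by rw [hUU, Matrix.one_mul, Matrix.mul_one]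
  rw [Matrix.mul_sub, Matrix.sub_mul, e, Matrix.sub_apply, hTxy] at hfin
  exact hfin

end EigenSystem

/-! ### Calculus of one-sided expansions with `O(δ²)` remainder. -/

section FirstOrder

/-- `f δ = a + δ b + O(δ²)` as `δ → 0⁺`. -/
def HasFirstOrder (f : ℝ → ℝ) (a b : ℝ) : Prop :=
  (fun δ => f δ - a - δ * b) =O[𝓝[>] (0 : ℝ)] fun δ => δ ^ 2

lemma isBigO_id_one : (fun δ : ℝ => δ) =O[𝓝[>] (0 : ℝ)] fun _ => (1 : ℝ) :=
  ((continuous_id.tendsto (0 : ℝ)).mono_left nhdsWithin_le_nhds).isBigO_one ℝ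

lemma isBigO_sq_id : (fun δ : ℝ => δ ^ 2) =O[𝓝[>] (0 : ℝ)] fun δ => δ := by
  simpa [sq] using isBigO_id_one.mul (isBigO_refl (fun δ : ℝ => δ) _)

variable {f g : ℝ → ℝ} {a b a' b' : ℝ}

lemma HasFirstOrder.sub_isBigO (hf : HasFirstOrder f a b) :
    (fun δ => f δ - a) =O[𝓝[>] (0 : ℝ)] fun δ => δ := by
  have h2 : (fun δ : ℝ => δ * b) =O[𝓝[>] (0 : ℝ)] fun δ => δ := by
    simpa [mul_comm] using (isBigO_refl (fun δ : ℝ => δ) (𝓝[>] (0 : ℝ))).const_mul_left b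
  simpa using (IsBigO.trans hf isBigO_sq_id).add h2

lemma HasFirstOrder.tendsto (hf : HasFirstOrder f a b) : Tendsto f (𝓝[>] 0) (𝓝 a) := by
  have h := hf.sub_isBigO.trans_tendsto
    ((continuous_id.tendsto (0 : ℝ)).mono_left nhdsWithin_le_nhds)
  simpa using h.add_const a

lemma hasFirstOrder_add_mul (a b : ℝ) : HasFirstOrder (fun δ => a + δ * b) a b := by
  simpa [HasFirstOrder] using isBigO_zero _ _

lemma HasFirstOrder.congr (hf : HasFirstOrder f a b) (h : f =ᶠ[𝓝[>] 0] g) (ha : a = a')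
    (hb : b = b') : HasFirstOrder g a' b' := by
  subst ha hb
  exact IsBigO.congr' hf (h.mono fun δ hδ => by simp [hδ]) EventuallyEq.rfl

lemma HasFirstOrder.add (hf : HasFirstOrder f a b) (hg : HasFirstOrder g a' b') :
    HasFirstOrder (fun δ => f δ + g δ) (a + a') (b + b') :=
  (IsBigO.add hf hg).congr_left fun δ => by ring

lemma HasFirstOrder.sub (hf : HasFirstOrder f a b) (hg : HasFirstOrder g a' b') :
    HasFirstOrder (fun δ => f δ - g δ) (a - a') (b - b') :=
  (IsBigO.sub hf hg).congr_left fun δ => by ring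

lemma HasFirstOrder.const_mul (c : ℝ) (hf : HasFirstOrder f a b) :
    HasFirstOrder (fun δ => c * f δ) (c * a) (c * b) :=
  (IsBigO.const_mul_left hf c).congr_left fun δ => by ring

lemma HasFirstOrder.mul (hf : HasFirstOrder f a b) (hg : HasFirstOrder g a' b') :
    HasFirstOrder (fun δ => f δ * g δ) (a * a') (b * a' + a * b') := by
  have h1 : (fun δ => (f δ - a) * (g δ - a')) =O[𝓝[>] (0 : ℝ)] fun δ => δ ^ 2 := by
    simpa [sq] using hf.sub_isBigO.mul hg.sub_isBigO
  exact (h1.add ((IsBigO.const_mul_left hf a').add (IsBigO.const_mul_left hg a))).congr_left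
    fun δ => by ring

lemma HasFirstOrder.sum {ι : Type*} {s : Finset ι} {f : ι → ℝ → ℝ} {a b : ι → ℝ}
    (h : ∀ i ∈ s, HasFirstOrder (f i) (a i) (b i)) :
    HasFirstOrder (fun δ => ∑ i ∈ s, f i δ) (∑ i ∈ s, a i) (∑ i ∈ s, b i) :=
  (IsBigO.fun_sum h).congr_left fun δ => by
    simp only [Finset.sum_sub_distrib, Finset.mul_sum]

/-- By the product rule, `f` minus the candidate affine function times `g` has vanishing expansion,
so it is `O(δ²)`; dividing by `g`, whose inverse is bounded near zero, preserves this. -/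
lemma HasFirstOrder.div (hf : HasFirstOrder f a b) (hg : HasFirstOrder g a' b') (ha' : a' ≠ 0) :
    HasFirstOrder (fun δ => f δ / g δ) (a / a') (b / a' - a * b' / a' ^ 2) := by
  have hne : ∀ᶠ δ in 𝓝[>] (0 : ℝ), g δ ≠ 0 := hg.tendsto.eventually_ne ha'
  have hinv : (fun δ => (g δ)⁻¹) =O[𝓝[>] (0 : ℝ)] fun _ => (1 : ℝ) :=
    (hg.tendsto.inv₀ ha').isBigO_one ℝ
  have hq : HasFirstOrder (fun δ => f δ - (a / a' + δ * (b / a' - a * b' / a' ^ 2)) * g δ) 0 0 :=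
    (hf.sub ((hasFirstOrder_add_mul (a / a') (b / a' - a * b' / a' ^ 2)).mul hg)).congr
      EventuallyEq.rfl (by field_simp; ring) (by field_simp; ring)
  have hq' : (fun δ => f δ - (a / a' + δ * (b / a' - a * b' / a' ^ 2)) * g δ)
      =O[𝓝[>] (0 : ℝ)] fun δ => δ ^ 2 := by simpa [HasFirstOrder] using hq
  have h := hq'.mul hinv
  simp only [mul_one] at h
  refine h.congr' (hne.mono fun δ hδ => ?_) EventuallyEq.rfl
  field_simp
  ring

lemma hasFirstOrder_inv_sqrt {a : ℝ} (ha : 0 ≤ a) :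
    HasFirstOrder (fun δ => (√(1 + δ * a))⁻¹) 1 (-(a / 2)) := by
  refine IsBigO.of_bound (a ^ 2) ?_
  filter_upwards [self_mem_nhdsWithin] with δ hδ
  have hδ0 : 0 ≤ δ * a := mul_nonneg (le_of_lt hδ) ha
  set s := √(1 + δ * a) with hs
  have hs2 : s ^ 2 = 1 + δ * a := Real.sq_sqrt (by linarith)
  have hs1 : 1 ≤ s := Real.one_le_sqrt.mpr (by linarith)
  -- With `δ a = s² - 1` the remainder is exactly `(s - 1)² (s + 2) / (2 s)`, and `s - 1` is at most
  -- `δ a / 2`.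
  have e : s⁻¹ - 1 - δ * -(a / 2) = (s - 1) ^ 2 * ((s + 2) / (2 * s)) := by
    have : δ * a = s ^ 2 - 1 := by linarith
    rw [show s⁻¹ - 1 - δ * -(a / 2) = s⁻¹ - 1 + δ * a / 2 by ring, this]
    field_simp
    ring
  have h1 : (s + 2) / (2 * s) ≤ 2 := by
    rw [div_le_iff₀ (by linarith)]; linarith
  have h2 : 0 ≤ (s + 2) / (2 * s) := by positivity
  have h3 : 2 * (s - 1) ≤ δ * a := by nlinarith
  rw [e, Real.norm_eq_abs, abs_of_nonneg (mul_nonneg (sq_nonneg _) h2), Real.norm_eq_abs,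
    abs_of_nonneg (sq_nonneg _)]
  calc (s - 1) ^ 2 * ((s + 2) / (2 * s)) ≤ (s - 1) ^ 2 * 2 := by gcongr
    _ ≤ (2 * (s - 1)) ^ 2 := by nlinarith [sq_nonneg (s - 1)]
    _ ≤ (δ * a) ^ 2 := by
        refine pow_le_pow_left₀ (by linarith) h3 2
    _ = a ^ 2 * δ ^ 2 := by ring

end FirstOrder

/-! ### The augmentation graph: positivity, degrees, and its first-order perturbation. -/

section Graph

variable {Ω : Type*} [MeasurableSpace Ω] {N : ℕ} (P Pl : Measure Ω) (T : Kernel Ω (Fin N)) (ηu : ℝ)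

lemma measurable_kernel_real_singleton (x : Fin N) : Measurable fun ω => (T ω).real {x} :=
  (T.measurable_coe (measurableSet_singleton x)).ennreal_toReal

lemma labelVec_nonneg (x : Fin N) : 0 ≤ labelVec Pl T x :=
  integral_nonneg fun _ => measureReal_nonneg

lemma adj_apply (δ : ℝ) (x y : Fin N) : adj P Pl T ηu δ x y
    = adj P Pl T ηu 0 x y + δ * (labelVec Pl T x * labelVec Pl T y) := by
  simp [adj, vecMulVec_apply]

lemma adj_zero_nonneg (hη : 0 ≤ ηu) (x y : Fin N) : 0 ≤ adj P Pl T ηu 0 x y := by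
  simp only [adj, zero_smul, add_zero, Matrix.smul_apply, smul_eq_mul, unlabeledAdj,
    Matrix.of_apply]
  exact mul_nonneg hη (integral_nonneg fun ω => mul_nonneg measureReal_nonneg measureReal_nonneg)

lemma adj_zero_symm (x y : Fin N) : adj P Pl T ηu 0 x y = adj P Pl T ηu 0 y x := by
  simp only [adj, zero_smul, add_zero, Matrix.smul_apply, smul_eq_mul, unlabeledAdj,
    Matrix.of_apply, mul_comm]

lemma dotProduct_normAdj (A : Matrix (Fin N) (Fin N) ℝ) (w : Fin N → ℝ) :
    w ⬝ᵥ (normAdj A *ᵥ w) =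
      (fun x => (√(deg A x))⁻¹ * w x) ⬝ᵥ (A *ᵥ fun x => (√(deg A x))⁻¹ * w x) := by
  simp only [dotProduct, Matrix.mulVec, Finset.mul_sum, normAdj, Matrix.of_apply]
  exact Finset.sum_congr rfl fun x _ => Finset.sum_congr rfl fun y _ => by ring

lemma normAdj_adj_zero (hdeg : ∀ x, deg (adj P Pl T ηu 0) x = 1) :
    normAdj (adj P Pl T ηu 0) = adj P Pl T ηu 0 := by
  ext x y
  simp [normAdj, hdeg]

lemma integrable_of_measurable_bounded [IsProbabilityMeasure P]
    {f : Ω → ℝ} (hf : Measurable f) {C : ℝ}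
    (hC : ∀ ω, |f ω| ≤ C) : Integrable f P :=
  Integrable.of_bound hf.aestronglyMeasurable C (Eventually.of_forall hC)

lemma integrable_kernel_real_singleton [IsProbabilityMeasure P] [IsMarkovKernel T]
    (x : Fin N) : Integrable (fun ω => (T ω).real {x}) P :=
  integrable_of_measurable_bounded P (measurable_kernel_real_singleton T x) (C := 1) fun ω => by
    rw [abs_of_nonneg measureReal_nonneg]; exact measureReal_le_one

lemma integrable_kernel_real_mul [IsProbabilityMeasure P] [IsMarkovKernel T] (x y : Fin N) :
    Integrable (fun ω => (T ω).real {x} * (T ω).real {y}) P :=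
  integrable_of_measurable_bounded P
    ((measurable_kernel_real_singleton T x).mul (measurable_kernel_real_singleton T y)) (C := 1)
    fun ω => by
      rw [abs_of_nonneg (mul_nonneg measureReal_nonneg measureReal_nonneg)]
      exact mul_le_one₀ measureReal_le_one measureReal_nonneg measureReal_le_one

lemma sum_labelVec [IsProbabilityMeasure Pl] [IsMarkovKernel T] : ∑ x, labelVec Pl T x = 1 := by
  simp only [labelVec]
  rw [← integral_finsetSum _ fun x _ => integrable_kernel_real_singleton Pl T x]
  simp

lemma labelVec_le_one [IsProbabilityMeasure Pl] [IsMarkovKernel T]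
    (x : Fin N) : labelVec Pl T x ≤ 1 := by
  rw [← sum_labelVec Pl T]
  exact Finset.single_le_sum (fun y _ => labelVec_nonneg Pl T y) (Finset.mem_univ x)

/-- The quadratic form is the expectation of the square `(∑ x, w x * T(x | ω))²`. -/
lemma dotProduct_unlabeledAdj_nonneg [IsProbabilityMeasure P] [IsMarkovKernel T] (w : Fin N → ℝ) :
    0 ≤ w ⬝ᵥ (unlabeledAdj P T *ᵥ w) := by
  have h : w ⬝ᵥ (unlabeledAdj P T *ᵥ w) = ∫ ω, (∑ x, w x * (T ω).real {x}) ^ 2 ∂P := by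
    have e : ∀ ω, (∑ x, w x * (T ω).real {x}) ^ 2
        = ∑ x, ∑ y, (w x * w y) * ((T ω).real {x} * (T ω).real {y}) := fun ω => by
      rw [sq, Finset.sum_mul_sum]
      exact Finset.sum_congr rfl fun x _ => Finset.sum_congr rfl fun y _ => by ring
    simp_rw [e]
    rw [integral_finsetSum _ fun x _ => integrable_finsetSum _ fun y _ =>
      (integrable_kernel_real_mul P T x y).const_mul _]
    simp only [dotProduct, Matrix.mulVec, Finset.mul_sum]
    refine Finset.sum_congr rfl fun x _ => ?_
    rw [integral_finsetSum _ fun y _ => (integrable_kernel_real_mul P T x y).const_mul _]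
    refine Finset.sum_congr rfl fun y _ => ?_
    rw [integral_const_mul]
    simp only [unlabeledAdj, Matrix.of_apply]
    ring
  rw [h]
  exact integral_nonneg fun _ => sq_nonneg _

lemma deg_adj [IsProbabilityMeasure Pl] [IsMarkovKernel T]
    (hdeg : ∀ x, deg (adj P Pl T ηu 0) x = 1) (δ : ℝ) (x : Fin N) :
    deg (adj P Pl T ηu δ) x = 1 + δ * labelVec Pl T x := by
  have h := hdeg x
  simp only [deg] at h ⊢
  simp_rw [adj_apply P Pl T ηu δ]
  rw [Finset.sum_add_distrib, h, ← Finset.mul_sum, ← Finset.mul_sum, sum_labelVec, mul_one]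

lemma dotProduct_adj_nonneg [IsProbabilityMeasure P] [IsMarkovKernel T]
    (hη : 0 ≤ ηu) {δ : ℝ} (hδ : 0 ≤ δ) (w : Fin N → ℝ) :
    0 ≤ w ⬝ᵥ (adj P Pl T ηu δ *ᵥ w) := by
  rw [adj, Matrix.add_mulVec, dotProduct_add, Matrix.smul_mulVec, Matrix.smul_mulVec,
    dotProduct_smul, dotProduct_smul, Matrix.vecMulVec_mulVec, smul_eq_mul, smul_eq_mul]
  refine add_nonneg (mul_nonneg hη (dotProduct_unlabeledAdj_nonneg P T w)) (mul_nonneg hδ ?_)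
  simpa [dotProduct_comm w] using mul_self_nonneg (labelVec Pl T ⬝ᵥ w)

/-- Needed because the features contain `√(E.val j)`, which squares back to the eigenvalue only when
it is nonnegative. Positivity of the form uses `0 ≤ δ`, matching the one-sided limits. -/
lemma EigenSystem.val_nonneg_of_adj [IsProbabilityMeasure P] [IsMarkovKernel T]
    (hη : 0 ≤ ηu) {δ : ℝ} (hδ : 0 ≤ δ)
    (E : EigenSystem (normAdj (adj P Pl T ηu δ))) (j : Fin N) : 0 ≤ E.val j := by
  rw [E.val_eq, dotProduct_normAdj]
  exact dotProduct_adj_nonneg P Pl T ηu hη hδ _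

/-- At `δ = 0` the matrix is symmetric and nonnegative with unit row sums, so `2 u_x u_y ≤ u_x² +
u_y²` bounds its Rayleigh quotients by one. -/
lemma EigenSystem.val_le_one_of_adj (hη : 0 ≤ ηu) (hdeg : ∀ x, deg (adj P Pl T ηu 0) x = 1)
    (E : EigenSystem (normAdj (adj P Pl T ηu 0))) (j : Fin N) : E.val j ≤ 1 := by
  rw [E.val_eq]
  have hu : ∑ x, (fun x => E.mat x j) x ^ 2 = 1 := E.sum_mat_sq j
  generalize (fun x => E.mat x j) = u at hu ⊢
  rw [normAdj_adj_zero P Pl T ηu hdeg]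
  set W := adj P Pl T ηu 0 with hW
  have hrow : ∀ x, ∑ y, W x y = 1 := hdeg
  calc u ⬝ᵥ (W *ᵥ u) = ∑ x, ∑ y, u x * (W x y * u y) := by
        simp only [dotProduct, Matrix.mulVec, Finset.mul_sum]
    _ ≤ ∑ x, ∑ y, (W x y * (u x ^ 2 / 2) + W y x * (u y ^ 2 / 2)) := by
        refine Finset.sum_le_sum fun x _ => Finset.sum_le_sum fun y _ => ?_
        rw [hW, adj_zero_symm P Pl T ηu y x, ← hW]
        have h0 : 0 ≤ W x y := adj_zero_nonneg P Pl T ηu hη x y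
        nlinarith [mul_nonneg h0 (sq_nonneg (u x - u y))]
    _ = 1 := by
        simp only [Finset.sum_add_distrib]
        rw [Finset.sum_comm (f := fun x y => W y x * (u y ^ 2 / 2))]
        simp only [← Finset.sum_mul, hrow, one_mul, ← Finset.sum_div, hu]
        norm_num

lemma hasFirstOrder_inv_sqrt_deg [IsProbabilityMeasure Pl] [IsMarkovKernel T]
    (hdeg : ∀ x, deg (adj P Pl T ηu 0) x = 1) (x : Fin N) :
    HasFirstOrder (fun δ => (√(deg (adj P Pl T ηu δ) x))⁻¹) 1 (-(labelVec Pl T x / 2)) := by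
  simp_rw [deg_adj P Pl T ηu hdeg]
  exact hasFirstOrder_inv_sqrt (labelVec_nonneg Pl T x)

lemma hasFirstOrder_normAdj [IsProbabilityMeasure Pl] [IsMarkovKernel T]
    (hdeg : ∀ x, deg (adj P Pl T ηu 0) x = 1) (x y : Fin N) :
    HasFirstOrder (fun δ => normAdj (adj P Pl T ηu δ) x y) (normAdj (adj P Pl T ηu 0) x y)
      ((vecMulVec (labelVec Pl T) (labelVec Pl T)
        - (1 / 2 : ℝ) • (diagonal (labelVec Pl T) * normAdj (adj P Pl T ηu 0)
          + normAdj (adj P Pl T ηu 0) * diagonal (labelVec Pl T))) x y) := by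
  refine (((hasFirstOrder_inv_sqrt_deg P Pl T ηu hdeg x).mul
    (hasFirstOrder_add_mul (adj P Pl T ηu 0 x y) (labelVec Pl T x * labelVec Pl T y))).mul
    (hasFirstOrder_inv_sqrt_deg P Pl T ηu hdeg y)).congr
    (Eventually.of_forall fun δ => ?_) ?_ ?_
  · simp only [normAdj, Matrix.of_apply]
    rw [adj_apply P Pl T ηu δ x y]
  · simp [normAdj_adj_zero P Pl T ηu hdeg]
  · rw [normAdj_adj_zero P Pl T ηu hdeg]
    simp only [Matrix.sub_apply, vecMulVec_apply, Matrix.smul_apply, Matrix.add_apply,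
      Matrix.diagonal_mul, Matrix.mul_diagonal, smul_eq_mul]
    ring

end Graph

/-! ### The Gram matrix of the features and the spectral gap in terms of indices. -/

section Features

variable {N k : ℕ}

lemma sum_castLE {k : ℕ} (hk : k ≤ N) (f : Fin N → ℝ) :
    ∑ j : Fin k, f (Fin.castLE hk j) = ∑ j : Fin N, if (j : ℕ) < k then f j else 0 := by
  obtain ⟨m, rfl⟩ := Nat.exists_eq_add_of_le hk
  rw [Fin.sum_univ_add]
  simp
  rfl

/-- This is what makes the result independent of the chosen eigenvectors: only the truncation enters
the Gram matrix. -/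
lemma inner_features {A : Matrix (Fin N) (Fin N) ℝ} (E : EigenSystem (normAdj A)) (hk : k ≤ N)
    (hnn : ∀ j, 0 ≤ E.val j) (x y : Fin N) :
    inner ℝ (features E hk x) (features E hk y)
      = (√(deg A x))⁻¹ * E.trunc k x y * (√(deg A y))⁻¹ := by
  rw [EigenSystem.trunc, mul_diagonal_mul_transpose_apply, PiLp.inner_apply, Finset.mul_sum,
    Finset.sum_mul]
  have h := sum_castLE hk fun j => (√(deg A x))⁻¹ * (E.vec j x * E.val j * E.vec j y)
    * (√(deg A y))⁻¹
  refine Eq.trans (Finset.sum_congr rfl fun j _ => ?_) (h.trans (Finset.sum_congr rfl fun j _ => ?_))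
  · simp only [features, RCLike.inner_apply, conj_trivial]
    have := Real.mul_self_sqrt (hnn (Fin.castLE hk j))
    linear_combination ((√(deg A x))⁻¹ * E.vec (Fin.castLE hk j) x * E.vec (Fin.castLE hk j) y
      * (√(deg A y))⁻¹) * this
  · split_ifs <;> simp [EigenSystem.mat]

lemma EigenSystem.transpose_mat_mulVec_eq_zero {M : Matrix (Fin N) (Fin N) ℝ} (E : EigenSystem M)
    (hk : k ≤ N) {v : Fin N → ℝ} (hv : WithLp.toLp 2 v ∈ E.topSpan hk) {j : Fin N}
    (hj : ¬ (j : ℕ) < k) : (E.matᵀ *ᵥ v) j = 0 := by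
  have h : ∀ w ∈ E.topSpan hk, inner ℝ (E.vec j) w = 0 := by
    intro w hw
    have hle : E.topSpan hk ≤ (Submodule.span ℝ {E.vec j})ᗮ := by
      refine Submodule.span_le.mpr ?_
      rintro _ ⟨i, rfl⟩
      refine Submodule.mem_orthogonal_singleton_iff_inner_right.mpr
        (E.vec.orthonormal.2 fun h => hj ?_)
      rw [h]
      exact i.2
    exact Submodule.mem_orthogonal_singleton_iff_inner_right.mp (hle hw)
  have := h _ hv
  rw [PiLp.inner_apply] at this
  simp only [Matrix.mulVec, dotProduct, Matrix.transpose_apply, EigenSystem.mat, Matrix.of_apply]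
  rw [← this]
  exact Finset.sum_congr rfl fun x _ => by simp [mul_comm]

lemma EigenSystem.invGap_nonneg {M : Matrix (Fin N) (Fin N) ℝ} (E : EigenSystem M)
    (hnn : ∀ j, 0 ≤ E.val j) (k : ℕ) : 0 ≤ E.invGap k := by
  have h : ∀ i, 0 ≤ E.nth i := fun i => by
    unfold EigenSystem.nth
    split_ifs
    · exact hnn _
    · exact le_rfl
  exact div_nonneg (h _) (h _)

lemma EigenSystem.nth_le_val {M : Matrix (Fin N) (Fin N) ℝ} (E : EigenSystem M)
    (hpos : 0 < E.nth k) {i : Fin N} (hi : (i : ℕ) < k) : E.nth k ≤ E.val i := by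
  unfold EigenSystem.nth at hpos ⊢
  -- Positivity of `E.nth k` excludes the default value `0`, hence gives `1 ≤ k ≤ N`; the `k`-th
  -- largest eigenvalue has index `k - 1`.
  split_ifs at hpos ⊢
  · exact E.antitone_val (Fin.le_def.mpr (by simp; omega))
  · exact absurd hpos (lt_irrefl _)

lemma EigenSystem.val_le_invGap_mul {M : Matrix (Fin N) (Fin N) ℝ} (E : EigenSystem M)
    (hpos : 0 < E.nth k) {j : Fin N} (hj : ¬ (j : ℕ) < k) : E.val j ≤ E.invGap k * E.nth k := by
  rw [EigenSystem.invGap, div_mul_cancel₀ _ hpos.ne', EigenSystem.nth, dif_pos (by omega)]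
  exact E.antitone_val (Fin.le_def.mpr (by simp; omega))

end Features

/-! ### The K-means scatters as linear functionals of the Gram matrix. -/

section KMeansGram

variable {N k : ℕ}

lemma sum_parts_sum {M : Type*} [AddCommMonoid M]
    (Cls : Finpartition (Finset.univ : Finset (Fin N))) (f : Fin N → M) :
    ∑ π ∈ Cls.parts, ∑ i ∈ π, f i = ∑ i, f i := by
  rw [← Finset.sum_biUnion (t := fun π => π) Cls.disjoint]
  exact congrArg (fun s => ∑ i ∈ s, f i) Cls.biUnion_parts

/-- The within-class scatter as a linear functional of the Gram matrix of the features. -/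
def intraGram (Cls : Finpartition (Finset.univ : Finset (Fin N))) (G : Fin N → Fin N → ℝ) : ℝ :=
  ∑ π ∈ Cls.parts, (∑ i ∈ π, G i i - (π.card : ℝ)⁻¹ * ∑ i ∈ π, ∑ j ∈ π, G i j)

/-- The between-class scatter as a linear functional of the Gram matrix of the features. -/
def interGram (Cls : Finpartition (Finset.univ : Finset (Fin N))) (G : Fin N → Fin N → ℝ) : ℝ :=
  ∑ π ∈ Cls.parts, (π.card : ℝ)⁻¹ * ∑ i ∈ π, ∑ j ∈ π, G i j - (N : ℝ)⁻¹ * ∑ i, ∑ j, G i j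

lemma inner_mean_mean (Z : Fin N → EuclideanSpace ℝ (Fin k)) (s t : Finset (Fin N)) :
    inner ℝ (mean Z s) (mean Z t) =
      (s.card : ℝ)⁻¹ * (t.card : ℝ)⁻¹ * ∑ i ∈ s, ∑ j ∈ t, inner ℝ (Z i) (Z j) := by
  rw [mean, mean, real_inner_smul_left, real_inner_smul_right, sum_inner, mul_assoc]
  simp only [inner_sum]

lemma card_smul_mean (Z : Fin N → EuclideanSpace ℝ (Fin k)) (s : Finset (Fin N)) :
    (s.card : ℝ) • mean Z s = ∑ i ∈ s, Z i := by
  rcases s.eq_empty_or_nonempty with rfl | hs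
  · simp
  · rw [mean, smul_smul, mul_inv_cancel₀ (by simpa using hs.ne_empty), one_smul]

lemma sum_norm_sub_mean_sq (Z : Fin N → EuclideanSpace ℝ (Fin k)) (s : Finset (Fin N)) :
    ∑ i ∈ s, ‖Z i - mean Z s‖ ^ 2 = ∑ i ∈ s, inner ℝ (Z i) (Z i)
      - (s.card : ℝ)⁻¹ * ∑ i ∈ s, ∑ j ∈ s, inner ℝ (Z i) (Z j) := by
  have h1 : ∀ i, ‖Z i - mean Z s‖ ^ 2 = inner ℝ (Z i) (Z i) - 2 * inner ℝ (Z i) (mean Z s)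
      + inner ℝ (mean Z s) (mean Z s) := fun i => by
    rw [norm_sub_sq_real, real_inner_self_eq_norm_sq, real_inner_self_eq_norm_sq]
  rw [Finset.sum_congr rfl fun i _ => h1 i, Finset.sum_add_distrib, Finset.sum_sub_distrib,
    ← Finset.mul_sum, ← sum_inner, Finset.sum_const, nsmul_eq_mul]
  have h2 : inner ℝ (∑ i ∈ s, Z i) (mean Z s) = (s.card : ℝ) * inner ℝ (mean Z s) (mean Z s) := by
    rw [← card_smul_mean, real_inner_smul_left]
  have h3 : ∑ i ∈ s, ∑ j ∈ s, inner ℝ (Z i) (Z j)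
      = (s.card : ℝ) * ((s.card : ℝ) * inner ℝ (mean Z s) (mean Z s)) := by
    rw [← real_inner_smul_right, ← real_inner_smul_left, card_smul_mean, sum_inner]
    simp only [inner_sum]
  rw [h2, h3]
  rcases s.eq_empty_or_nonempty with rfl | hs
  · simp
  · have : (s.card : ℝ) ≠ 0 := by simpa using hs.ne_empty
    field_simp
    ring

lemma intraClass_eq (Cls : Finpartition (Finset.univ : Finset (Fin N)))
    (Z : Fin N → EuclideanSpace ℝ (Fin k)) :
    intraClass Cls Z = intraGram Cls fun i j => inner ℝ (Z i) (Z j) :=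
  Finset.sum_congr rfl fun π _ => sum_norm_sub_mean_sq Z π

lemma card_mul_inner_mean_self (Z : Fin N → EuclideanSpace ℝ (Fin k)) (s : Finset (Fin N)) :
    (s.card : ℝ) * inner ℝ (mean Z s) (mean Z s)
      = (s.card : ℝ)⁻¹ * ∑ i ∈ s, ∑ j ∈ s, inner ℝ (Z i) (Z j) := by
  rw [inner_mean_mean]
  rcases s.eq_empty_or_nonempty with rfl | hs
  · simp
  · have : (s.card : ℝ) ≠ 0 := by simpa using hs.ne_empty
    field_simp

lemma interClass_eq (Cls : Finpartition (Finset.univ : Finset (Fin N)))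
    (Z : Fin N → EuclideanSpace ℝ (Fin k)) :
    interClass Cls Z = interGram Cls fun i j => inner ℝ (Z i) (Z j) := by
  set μ := mean Z Finset.univ with hμ
  have h1 : ∀ π : Finset (Fin N), (π.card : ℝ) * ‖mean Z π - μ‖ ^ 2
      = (π.card : ℝ)⁻¹ * ∑ i ∈ π, ∑ j ∈ π, inner ℝ (Z i) (Z j)
        - 2 * inner ℝ (∑ i ∈ π, Z i) μ + (π.card : ℝ) * inner ℝ μ μ := fun π => by
    rw [norm_sub_sq_real, ← real_inner_self_eq_norm_sq, ← real_inner_self_eq_norm_sq,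
      ← card_smul_mean, real_inner_smul_left, ← card_mul_inner_mean_self]
    ring
  have hcard : ∑ π ∈ Cls.parts, (π.card : ℝ) = N := by
    have := Cls.sum_card_parts
    rw [Finset.card_univ, Fintype.card_fin] at this
    exact_mod_cast this
  have hall : (N : ℝ) • μ = ∑ i, Z i := by
    have := card_smul_mean Z Finset.univ
    rwa [Finset.card_univ, Fintype.card_fin] at this
  have hμμ : (N : ℝ) * inner ℝ μ μ = (N : ℝ)⁻¹ * ∑ i, ∑ j, inner ℝ (Z i) (Z j) := by
    have := card_mul_inner_mean_self Z Finset.univ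
    rwa [Finset.card_univ, Fintype.card_fin] at this
  unfold interClass interGram
  simp only [← hμ, h1]
  rw [Finset.sum_add_distrib, Finset.sum_sub_distrib, ← Finset.mul_sum, ← sum_inner,
    sum_parts_sum, ← hall, ← Finset.sum_mul, hcard, real_inner_smul_left, ← hμμ]
  ring

lemma HasFirstOrder.intraGram (Cls : Finpartition (Finset.univ : Finset (Fin N)))
    {G : ℝ → Fin N → Fin N → ℝ} {G₀ G₁ : Fin N → Fin N → ℝ}
    (h : ∀ i j, HasFirstOrder (fun δ => G δ i j) (G₀ i j) (G₁ i j)) :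
    HasFirstOrder (fun δ => intraGram Cls (G δ)) (intraGram Cls G₀) (intraGram Cls G₁) :=
  HasFirstOrder.sum fun _ _ => (HasFirstOrder.sum fun i _ => h i i).sub
    ((HasFirstOrder.sum fun i _ => HasFirstOrder.sum fun j _ => h i j).const_mul _)

lemma HasFirstOrder.interGram (Cls : Finpartition (Finset.univ : Finset (Fin N)))
    {G : ℝ → Fin N → Fin N → ℝ} {G₀ G₁ : Fin N → Fin N → ℝ}
    (h : ∀ i j, HasFirstOrder (fun δ => G δ i j) (G₀ i j) (G₁ i j)) :
    HasFirstOrder (fun δ => interGram Cls (G δ)) (interGram Cls G₀) (interGram Cls G₁) :=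
  (HasFirstOrder.sum fun _ _ =>
      (HasFirstOrder.sum fun i _ => HasFirstOrder.sum fun j _ => h i j).const_mul _).sub
    ((HasFirstOrder.sum fun i _ => HasFirstOrder.sum fun j _ => h i j).const_mul _)

lemma intraGram_add (Cls : Finpartition (Finset.univ : Finset (Fin N)))
    (G H : Fin N → Fin N → ℝ) :
    intraGram Cls (fun i j => G i j + H i j) = intraGram Cls G + intraGram Cls H := by
  rw [intraGram, intraGram, intraGram, ← Finset.sum_add_distrib]
  refine Finset.sum_congr rfl fun π _ => ?_
  simp only [Finset.sum_add_distrib]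
  ring

lemma interGram_add (Cls : Finpartition (Finset.univ : Finset (Fin N)))
    (G H : Fin N → Fin N → ℝ) :
    interGram Cls (fun i j => G i j + H i j) = interGram Cls G + interGram Cls H := by
  simp only [interGram, Finset.sum_add_distrib, mul_add]
  ring

/-- The inverse cardinality cancels one of the two factors `s.card`, so that summing over a
partition costs only a factor `N`. -/
lemma abs_inv_card_mul_sum_le {R : Fin N → Fin N → ℝ} {r : ℝ} (hR : ∀ i j, |R i j| ≤ r)
    (s : Finset (Fin N)) : |(s.card : ℝ)⁻¹ * ∑ i ∈ s, ∑ j ∈ s, R i j| ≤ s.card * r := by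
  have h : |∑ i ∈ s, ∑ j ∈ s, R i j| ≤ (s.card : ℝ) * (s.card * r) := by
    calc _ ≤ ∑ i ∈ s, |∑ j ∈ s, R i j| := Finset.abs_sum_le_sum_abs _ _
      _ ≤ ∑ i ∈ s, ∑ j ∈ s, r := Finset.sum_le_sum fun i _ =>
          (Finset.abs_sum_le_sum_abs _ _).trans (Finset.sum_le_sum fun j _ => hR i j)
      _ = _ := by simp
  rw [abs_mul, abs_of_nonneg (by positivity : (0 : ℝ) ≤ (s.card : ℝ)⁻¹)]
  rcases s.eq_empty_or_nonempty with rfl | hs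
  · simp
  · have : (0 : ℝ) < s.card := by exact_mod_cast hs.card_pos
    rwa [inv_mul_le_iff₀ this]

lemma sum_card_mul_eq (Cls : Finpartition (Finset.univ : Finset (Fin N))) (r : ℝ) :
    ∑ π ∈ Cls.parts, (π.card : ℝ) * r = N * r := by
  have := Cls.sum_card_parts
  rw [Finset.card_univ, Fintype.card_fin] at this
  rw [← Finset.sum_mul]
  congr 1
  exact_mod_cast this

lemma abs_intraGram_le (Cls : Finpartition (Finset.univ : Finset (Fin N)))
    {R : Fin N → Fin N → ℝ} {r : ℝ} (hR : ∀ i j, |R i j| ≤ r) :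
    |intraGram Cls R| ≤ 2 * N * r := by
  calc |intraGram Cls R| ≤ ∑ π ∈ Cls.parts, (π.card : ℝ) * (2 * r) := by
        refine (Finset.abs_sum_le_sum_abs _ _).trans (Finset.sum_le_sum fun π _ => ?_)
        have h1 : |∑ i ∈ π, R i i| ≤ π.card * r :=
          (Finset.abs_sum_le_sum_abs _ _).trans
            ((Finset.sum_le_sum fun i _ => hR i i).trans (by simp))
        have h2 := abs_inv_card_mul_sum_le hR π
        exact (abs_sub _ _).trans (by linarith)
    _ = 2 * N * r := by rw [sum_card_mul_eq]; ring

lemma abs_interGram_le (Cls : Finpartition (Finset.univ : Finset (Fin N)))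
    {R : Fin N → Fin N → ℝ} {r : ℝ} (hR : ∀ i j, |R i j| ≤ r) :
    |interGram Cls R| ≤ 2 * N * r := by
  have h1 : |∑ π ∈ Cls.parts, (π.card : ℝ)⁻¹ * ∑ i ∈ π, ∑ j ∈ π, R i j| ≤ N * r := by
    rw [← sum_card_mul_eq Cls]
    exact (Finset.abs_sum_le_sum_abs _ _).trans
      (Finset.sum_le_sum fun π _ => abs_inv_card_mul_sum_le hR π)
  have h2 := abs_inv_card_mul_sum_le hR Finset.univ
  rw [Finset.card_univ, Fintype.card_fin] at h2
  exact (abs_sub _ _).trans (by linarith)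

/-! ### Scatters of the derivative when the labels are constant on classes. -/

section Constant

variable {Cls : Finpartition (Finset.univ : Finset (Fin N))} {v : Fin N → ℝ}
  {lc : Finset (Fin N) → ℝ}

lemma sum_card_mul_of_const (hv : ∀ π ∈ Cls.parts, ∀ i ∈ π, v i = lc π) :
    ∑ π ∈ Cls.parts, (π.card : ℝ) * lc π = ∑ i, v i := by
  rw [← sum_parts_sum Cls]
  refine Finset.sum_congr rfl fun π hπ => ?_
  rw [Finset.sum_congr rfl (hv π hπ)]
  simp

/-- The matrix `v vᵀ` is the Gram matrix of the scalar feature `v`, which does not vary within a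
class. -/
lemma intraGram_vecMulVec (hv : ∀ π ∈ Cls.parts, ∀ i ∈ π, v i = lc π) :
    intraGram Cls (fun i j => v i * v j) = 0 := by
  refine Finset.sum_eq_zero fun π hπ => ?_
  rw [← Finset.sum_mul_sum, Finset.sum_congr rfl (hv π hπ),
    Finset.sum_congr rfl fun i hi => show v i * v i = lc π * lc π by rw [hv π hπ i hi]]
  have : (π.card : ℝ) ≠ 0 := by simpa using (Cls.nonempty_of_mem_parts hπ).ne_empty
  simp only [Finset.sum_const, nsmul_eq_mul]
  field_simp
  ring

lemma intraGram_weighted (hv : ∀ π ∈ Cls.parts, ∀ i ∈ π, v i = lc π)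
    (Z : Fin N → EuclideanSpace ℝ (Fin k)) :
    intraGram Cls (fun i j => -((v i + v j) * inner ℝ (Z i) (Z j)))
      = -(2 * weightedScatter Cls Z lc) := by
  rw [weightedScatter, Finset.mul_sum, ← Finset.sum_neg_distrib]
  refine Finset.sum_congr rfl fun π hπ => ?_
  rw [sum_norm_sub_mean_sq]
  have h : ∀ i ∈ π, ∀ j ∈ π, -((v i + v j) * inner ℝ (Z i) (Z j))
      = -(2 * lc π) * inner ℝ (Z i) (Z j) := fun i hi j hj => by
    rw [hv π hπ i hi, hv π hπ j hj]; ring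
  rw [Finset.sum_congr rfl fun i hi => h i hi i hi,
    Finset.sum_congr rfl fun i hi => Finset.sum_congr rfl (h i hi)]
  simp only [← Finset.mul_sum]
  ring

lemma interGram_vecMulVec (hv : ∀ π ∈ Cls.parts, ∀ i ∈ π, v i = lc π) (hv1 : ∑ i, v i = 1) :
    interGram Cls (fun i j => v i * v j)
      = ∑ π ∈ Cls.parts, (π.card : ℝ) * lc π * (lc π - 1 / N) := by
  have h : ∀ π ∈ Cls.parts, (π.card : ℝ)⁻¹ * ∑ i ∈ π, ∑ j ∈ π, v i * v j
      = (π.card : ℝ) * lc π * lc π := fun π hπ => by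
    rw [← Finset.sum_mul_sum, Finset.sum_congr rfl (hv π hπ)]
    have : (π.card : ℝ) ≠ 0 := by simpa using (Cls.nonempty_of_mem_parts hπ).ne_empty
    simp only [Finset.sum_const, nsmul_eq_mul]
    field_simp
  simp only [interGram, mul_sub, Finset.sum_sub_distrib, ← Finset.sum_mul]
  rw [sum_card_mul_of_const hv, Finset.sum_congr rfl h, ← Finset.sum_mul_sum, hv1]
  simp

/-- Explains the weight in `classPert`: as `1 - |π|/N = |πᶜ|/N`, it turns the average over `πᶜ` into
a sum divided by `N`, which merges with the sum over `π` into the sum over all vertices. -/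
lemma card_mul_avgSim_sub (Z : Fin N → EuclideanSpace ℝ (Fin k)) {π : Finset (Fin N)}
    (hπ : π.Nonempty) :
    (π.card : ℝ) * ((1 - (π.card : ℝ) / N) * (avgSim Z π π - avgSim Z π πᶜ))
      = (π.card : ℝ)⁻¹ * ∑ i ∈ π, ∑ j ∈ π, inner ℝ (Z i) (Z j)
        - (N : ℝ)⁻¹ * ∑ i ∈ π, ∑ j, inner ℝ (Z i) (Z j) := by
  have hp : (0 : ℝ) < π.card := by exact_mod_cast hπ.card_pos
  have hcard : (π.card : ℝ) + (πᶜ.card : ℝ) = N := by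
    have := Finset.card_add_card_compl π
    rw [Fintype.card_fin] at this
    exact_mod_cast this
  have hsplit : ∑ i ∈ π, ∑ j, (inner ℝ (Z i) (Z j) : ℝ)
      = ∑ i ∈ π, ∑ j ∈ π, inner ℝ (Z i) (Z j) + ∑ i ∈ π, ∑ j ∈ πᶜ, inner ℝ (Z i) (Z j) := by
    rw [← Finset.sum_add_distrib]
    exact Finset.sum_congr rfl fun i _ => (Finset.sum_add_sum_compl π _).symm
  simp only [avgSim, ← Finset.mul_sum]
  rw [hsplit]
  -- For a single class the average over `πᶜ` takes the default value `0`, but its coefficient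
  -- vanishes, so the identity persists.
  rcases (πᶜ).eq_empty_or_nonempty with hc | hc
  · simp only [hc, Finset.card_empty, Nat.cast_zero, add_zero] at hcard ⊢
    have hN : (N : ℝ) ≠ 0 := by rw [← hcard]; exact hp.ne'
    rw [hcard]
    simp [hN]
  · have hq : (0 : ℝ) < πᶜ.card := by exact_mod_cast hc.card_pos
    rw [← hcard]
    have : (π.card : ℝ) + πᶜ.card ≠ 0 := by positivity
    field_simp
    ring

lemma interGram_weighted (hv : ∀ π ∈ Cls.parts, ∀ i ∈ π, v i = lc π)
    (Z : Fin N → EuclideanSpace ℝ (Fin k)) :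
    interGram Cls (fun i j => -((v i + v j) * inner ℝ (Z i) (Z j)))
      = -∑ π ∈ Cls.parts, (π.card : ℝ) * lc π *
          (2 * (1 - (π.card : ℝ) / N) * (avgSim Z π π - avgSim Z π πᶜ)) := by
  have h1 : ∀ π ∈ Cls.parts, (π.card : ℝ)⁻¹ * ∑ i ∈ π, ∑ j ∈ π,
      -((v i + v j) * inner ℝ (Z i) (Z j))
      = -(2 * lc π * ((π.card : ℝ)⁻¹ * ∑ i ∈ π, ∑ j ∈ π, inner ℝ (Z i) (Z j))) := fun π hπ => by
    have h : ∀ i ∈ π, ∀ j ∈ π, -((v i + v j) * inner ℝ (Z i) (Z j))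
        = -(2 * lc π) * inner ℝ (Z i) (Z j) := fun i hi j hj => by
      rw [hv π hπ i hi, hv π hπ j hj]; ring
    rw [Finset.sum_congr rfl fun i hi => Finset.sum_congr rfl (h i hi)]
    simp only [← Finset.mul_sum]
    ring
  have h2 : ∑ i, ∑ j, -((v i + v j) * inner ℝ (Z i) (Z j))
      = -∑ π ∈ Cls.parts, 2 * lc π * ∑ i ∈ π, ∑ j, inner ℝ (Z i) (Z j) := by
    -- Symmetry of the Gram matrix makes the two halves of `v i + v j` contribute equally to the
    -- total sum.
    have e1 : ∑ i, ∑ j, v j * inner ℝ (Z i) (Z j) = ∑ i, v i * ∑ j, inner ℝ (Z i) (Z j) := by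
      rw [Finset.sum_comm]
      refine Finset.sum_congr rfl fun i _ => ?_
      rw [Finset.mul_sum]
      exact Finset.sum_congr rfl fun j _ => by rw [real_inner_comm]
    have e2 : ∑ i, v i * ∑ j, inner ℝ (Z i) (Z j)
        = ∑ π ∈ Cls.parts, lc π * ∑ i ∈ π, ∑ j, inner ℝ (Z i) (Z j) := by
      rw [← sum_parts_sum Cls]
      refine Finset.sum_congr rfl fun π hπ => ?_
      rw [Finset.mul_sum]
      exact Finset.sum_congr rfl fun i hi => by rw [hv π hπ i hi]
    simp only [add_mul, Finset.sum_neg_distrib, Finset.sum_add_distrib, e1, ← Finset.mul_sum, e2,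
      mul_assoc]
    ring
  rw [interGram, Finset.sum_congr rfl h1, h2, mul_neg, Finset.mul_sum, sub_neg_eq_add,
    ← Finset.sum_neg_distrib, ← Finset.sum_add_distrib]
  refine Finset.sum_congr rfl fun π hπ => ?_
  have := card_mul_avgSim_sub Z (Cls.nonempty_of_mem_parts hπ)
  linear_combination (2 * lc π) * this

end Constant

end KMeansGram

/-! ### Expansions of the Gram matrix and of the K-means measure. -/

section Main

variable {Ω : Type*} [MeasurableSpace Ω] {N k : ℕ} (P Pl : Measure Ω)
  [IsProbabilityMeasure P] [IsProbabilityMeasure Pl] (T : Kernel Ω (Fin N)) [IsMarkovKernel T]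
  {ηu : ℝ}

/-- First-order expansion of the Gram matrix of the spectral features: the derivative is
`𝔩𝔩ᵀ - (L G + G L)`, where `L = diag 𝔩`, up to an error proportional to the reciprocal gap. -/
theorem exists_hasFirstOrder_gram (hη : 0 < ηu) (hdeg : ∀ x, deg (adj P Pl T ηu 0) x = 1)
    (hk : k ≤ N) (E : ∀ δ : ℝ, EigenSystem (normAdj (adj P Pl T ηu δ)))
    (hpos : 0 < (E 0).nth k) (hgap : (E 0).invGap k ≤ 1 / 2)
    (hspan : WithLp.toLp 2 (labelVec Pl T) ∈ (E 0).topSpan hk) :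
    ∃ R : Fin N → Fin N → ℝ, (∀ x y, |R x y| ≤ (N : ℝ) ^ 2 * (2 * N * (E 0).invGap k)) ∧
      ∀ x y, HasFirstOrder
        (fun δ => inner ℝ (features (E δ) hk x) (features (E δ) hk y))
        (inner ℝ (features (E 0) hk x) (features (E 0) hk y))
        (labelVec Pl T x * labelVec Pl T y
          + -((labelVec Pl T x + labelVec Pl T y)
            * inner ℝ (features (E 0) hk x) (features (E 0) hk y)) + R x y) := by
  set v := labelVec Pl T with hv
  set A' := vecMulVec v v - (1 / 2 : ℝ) • (diagonal v * normAdj (adj P Pl T ηu 0)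
    + normAdj (adj P Pl T ηu 0) * diagonal v) with hA'
  set H := (E 0).mat * Matrix.of (truncDeriv (fun j : Fin N => (j : ℕ) < k) (E 0).val
            ((E 0).matᵀ * A' * (E 0).mat)) * (E 0).matᵀ with hH
  have hnn : ∀ {δ : ℝ}, 0 ≤ δ → ∀ j, 0 ≤ (E δ).val j := fun hδ j =>
    (E _).val_nonneg_of_adj P Pl T ηu hη.le hδ j
  have hg0 := (E 0).invGap_nonneg (hnn le_rfl) k
  have hgap' : ∀ i j : Fin N, (i : ℕ) < k → ¬ (j : ℕ) < k →
      0 < (E 0).val i ∧ (E 0).val j ≤ (E 0).invGap k * (E 0).val i := fun i j hi hj => by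
    have h1 := (E 0).nth_le_val hpos hi
    exact ⟨hpos.trans_le h1, ((E 0).val_le_invGap_mul hpos hj).trans
      (mul_le_mul_of_nonneg_left h1 hg0)⟩
  have htr : ∀ x y, HasFirstOrder (fun δ => (E δ).trunc k x y) ((E 0).trunc k x y) (H x y) :=
    EigenSystem.trunc_expansion E k A' (hasFirstOrder_normAdj P Pl T ηu hdeg)
      -- As the reciprocal gap is at most `1/2`, every discarded eigenvalue is at most half of the
      -- `k`-th one, which leaves this separation.
      (γ := (E 0).nth k / 2) (by linarith) fun i j hi hj => by
        have h1 := (E 0).nth_le_val hpos hi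
        have h2 := (E 0).val_le_invGap_mul hpos hj
        nlinarith
  refine ⟨fun x y => H x y - (v x * v y - (v x + v y) / 2 * (E 0).trunc k x y), ?_, ?_⟩
  · exact (E 0).abs_truncDeriv_sub_le k v
      (fun x => by
        rw [abs_of_nonneg (labelVec_nonneg Pl T x)]; exact labelVec_le_one Pl T x)
      (fun j hj => (E 0).transpose_mat_mulVec_eq_zero hk hspan hj) hgap hg0 (hnn le_rfl)
      (fun j => (E 0).val_le_one_of_adj P Pl T ηu hη.le hdeg j) hgap'
  · intro x y
    have h0 : inner ℝ (features (E 0) hk x) (features (E 0) hk y) = (E 0).trunc k x y := by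
      rw [inner_features (E 0) hk (hnn le_rfl), hdeg, hdeg]
      simp
    rw [h0]
    -- The two degree factors contribute another `-(v x + v y) / 2` times the truncation, doubling
    -- the term already in its derivative.
    refine (((hasFirstOrder_inv_sqrt_deg P Pl T ηu hdeg x).mul (htr x y)).mul
      (hasFirstOrder_inv_sqrt_deg P Pl T ηu hdeg y)).congr ?_ (by ring) (by rw [← hv]; ring)
    filter_upwards [self_mem_nhdsWithin] with δ hδ
    exact (inner_features (E δ) hk (hnn (le_of_lt hδ)) x y).symm

/-- First-order expansion of the K-means measure. -/
theorem exists_hasFirstOrder_kms (hη : 0 < ηu) (hdeg : ∀ x, deg (adj P Pl T ηu 0) x = 1)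
    (hk : k ≤ N) (E : ∀ δ : ℝ, EigenSystem (normAdj (adj P Pl T ηu δ)))
    (hpos : 0 < (E 0).nth k) (hgap : (E 0).invGap k ≤ 1 / 2)
    (hspan : WithLp.toLp 2 (labelVec Pl T) ∈ (E 0).topSpan hk)
    (Cls : Finpartition (Finset.univ : Finset (Fin N))) (lc : Finset (Fin N) → ℝ)
    (hlc : ∀ π ∈ Cls.parts, ∀ i ∈ π, labelVec Pl T i = lc π)
    (hinter : 0 < interClass Cls (features (E 0) hk)) :
    ∃ a b : ℝ, |a| ≤ 4 * (N : ℝ) ^ 4 * (E 0).invGap k ∧ |b| ≤ 4 * (N : ℝ) ^ 4 * (E 0).invGap k ∧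
      HasFirstOrder (fun δ => kms Cls (features (E δ) hk)) (kms Cls (features (E 0) hk))
        ((-(2 * weightedScatter Cls (features (E 0) hk) lc) + a)
            / interClass Cls (features (E 0) hk)
          - intraClass Cls (features (E 0) hk)
            * (∑ π ∈ Cls.parts, (π.card : ℝ) * lc π * classPert (features (E 0) hk) (lc π) π + b)
            / interClass Cls (features (E 0) hk) ^ 2) := by
  obtain ⟨R, hR, hG⟩ := exists_hasFirstOrder_gram P Pl T hη hdeg hk E hpos hgap hspan
  -- The factor `2N` comes from the scatter functionals, `N²` from returning to the standard basis,
  -- and `2N` times the reciprocal gap from the mixed entries.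
  have hbound : 2 * (N : ℝ) * ((N : ℝ) ^ 2 * (2 * N * (E 0).invGap k))
      = 4 * (N : ℝ) ^ 4 * (E 0).invGap k := by ring
  refine ⟨intraGram Cls R, interGram Cls R, hbound ▸ abs_intraGram_le Cls hR,
    hbound ▸ abs_interGram_le Cls hR, ?_⟩
  have h1 := HasFirstOrder.intraGram Cls hG
  have h2 := HasFirstOrder.interGram Cls hG
  simp only [← intraClass_eq] at h1
  simp only [← interClass_eq] at h2
  rw [intraGram_add, intraGram_add, intraGram_vecMulVec hlc, intraGram_weighted hlc, zero_add] at h1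
  rw [interGram_add, interGram_add, interGram_vecMulVec hlc (sum_labelVec Pl T),
    interGram_weighted hlc, ← Finset.sum_neg_distrib, ← Finset.sum_add_distrib] at h2
  refine (h1.div h2 hinter.ne').congr EventuallyEq.rfl rfl ?_
  congr 4
  exact Finset.sum_congr rfl fun π _ => by rw [classPert]; ring

end Main

/-! ### From the expansion to the inequalities of the theorem. -/

lemma weightedScatter_nonneg {N k : ℕ} {Cls : Finpartition (Finset.univ : Finset (Fin N))}
    (Z : Fin N → EuclideanSpace ℝ (Fin k)) {lc : Finset (Fin N) → ℝ}
    (hlc : ∀ π ∈ Cls.parts, 0 ≤ lc π) : 0 ≤ weightedScatter Cls Z lc :=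
  Finset.sum_nonneg fun π hπ =>
    mul_nonneg (hlc π hπ) (Finset.sum_nonneg fun _ _ => sq_nonneg _)

lemma intraClass_nonneg {N k : ℕ} (Cls : Finpartition (Finset.univ : Finset (Fin N)))
    (Z : Fin N → EuclideanSpace ℝ (Fin k)) : 0 ≤ intraClass Cls Z :=
  Finset.sum_nonneg fun _ _ => Finset.sum_nonneg fun _ _ => sq_nonneg _

/-- A lower bound for the decrement of a function from a lower bound on its first-order term. -/
lemma HasFirstOrder.exists_eventually_le {f : ℝ → ℝ} {a b : ℝ} (hf : HasFirstOrder f a b) :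
    ∃ C : ℝ, 0 ≤ C ∧ ∀ᶠ δ in 𝓝[>] (0 : ℝ), -b * δ - C * δ ^ 2 ≤ a - f δ := by
  obtain ⟨C, hC, h⟩ := IsBigO.exists_nonneg hf
  refine ⟨C, hC, h.bound.mono fun δ hδ => ?_⟩
  rw [Real.norm_eq_abs, Real.norm_eq_abs, abs_of_nonneg (sq_nonneg δ)] at hδ
  linarith [(abs_le.mp hδ).2]

lemma HasFirstOrder.eventually_le {f : ℝ → ℝ} {a b m : ℝ} (hf : HasFirstOrder f a b)
    (hm : m < -b) : ∀ᶠ δ in 𝓝[>] (0 : ℝ), δ * m ≤ a - f δ := by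
  obtain ⟨C, hC, h⟩ := hf.exists_eventually_le
  have ht : Tendsto (fun δ : ℝ => C * δ) (𝓝[>] 0) (𝓝 0) := by
    simpa using ((continuous_id.tendsto (0 : ℝ)).mono_left nhdsWithin_le_nhds).const_mul C
  filter_upwards [h, self_mem_nhdsWithin, ht.eventually (ge_mem_nhds (sub_pos.mpr hm))]
    with δ h1 hδ h2
  have hδ' : 0 < δ := hδ
  nlinarith

end SORL

end

theorem theorem4p4 (N : ℕ) :
    ∃ K : ℝ, 0 < K ∧
      ∀ (Ω : Type*) [MeasurableSpace Ω] (P Pl : Measure Ω)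
        [IsProbabilityMeasure P] [IsProbabilityMeasure Pl]
        (T : Kernel Ω (Fin N)) [IsMarkovKernel T] (ηu : ℝ) (_ : 0 < ηu)
        -- all vertices of the unperturbed graph have degree one
        (_ : ∀ x, SORL.deg (SORL.adj P Pl T ηu 0) x = 1)
        (k : ℕ) (hk : k ≤ N)
        -- for every `δ`, any choice of the ordered eigenbasis of the normalized adjacency matrix
        (E : ∀ δ : ℝ, SORL.EigenSystem (SORL.normAdj (SORL.adj P Pl T ηu δ)))
        -- the spectral gap is well defined and large
        (_ : 0 < (E 0).nth k) (_ : (E 0).invGap k ≤ 1 / 2)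
        -- `𝔩` lies in the span of the top-`k` eigenvectors of the unperturbed graph
        (_ : WithLp.toLp 2 (SORL.labelVec Pl T) ∈ (E 0).topSpan hk)
        -- `𝔩` is constant on each class
        (Cls : Finpartition (Finset.univ : Finset (Fin N))) (lc : Finset (Fin N) → ℝ)
        (_ : ∀ π ∈ Cls.parts, ∀ i ∈ π, SORL.labelVec Pl T i = lc π)
        (_ : 0 < SORL.interClass Cls (SORL.features (E 0) hk))
        (η₁ η₂ : ℝ) (_ : η₁ = 1 / SORL.interClass Cls (SORL.features (E 0) hk))
        (_ : η₂ = SORL.intraClass Cls (SORL.features (E 0) hk) /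
          SORL.interClass Cls (SORL.features (E 0) hk)),
        (∃ C : ℝ, ∀ᶠ δ in 𝓝[>] (0 : ℝ),
          SORL.kms Cls (SORL.features (E 0) hk) - SORL.kms Cls (SORL.features (E δ) hk) ≥
            δ * η₁ * η₂ * ∑ π ∈ Cls.parts,
                (π.card : ℝ) * lc π * SORL.classPert (SORL.features (E 0) hk) (lc π) π
              - K * η₁ * (1 + η₂) * (E 0).invGap k * δ - C * δ ^ 2) ∧
        (K * (1 + η₂) * (E 0).invGap k <
            SORL.weightedScatter Cls (SORL.features (E 0) hk) lc →
          ∀ᶠ δ in 𝓝[>] (0 : ℝ),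
            SORL.kms Cls (SORL.features (E 0) hk) - SORL.kms Cls (SORL.features (E δ) hk) ≥
              δ * η₁ * η₂ * ∑ π ∈ Cls.parts,
                (π.card : ℝ) * lc π * SORL.classPert (SORL.features (E 0) hk) (lc π) π) := by
  -- The bound on both gap errors `a` and `b` is `4 N⁴` times the reciprocal gap; adding one keeps
  -- the constant positive when `N = 0`.
  refine ⟨4 * (N : ℝ) ^ 4 + 1, by positivity, ?_⟩
  intro Ω _ P Pl _ _ T _ ηu hη hdeg k hk E hpos hgap hspan Cls lc hlc hinter η₁ η₂ hη₁ hη₂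
  obtain ⟨a, b, ha, hb, hf⟩ :=
    SORL.exists_hasFirstOrder_kms P Pl T hη hdeg hk E hpos hgap hspan Cls lc hlc hinter
  set g := (E 0).invGap k
  set W := SORL.weightedScatter Cls (SORL.features (E 0) hk) lc
  set S := ∑ π ∈ Cls.parts, (π.card : ℝ) * lc π * SORL.classPert (SORL.features (E 0) hk) (lc π) π
  have hg0 : 0 ≤ g := (E 0).invGap_nonneg
    (fun j => (E 0).val_nonneg_of_adj P Pl T ηu hη.le le_rfl j) k
  have hW : 0 ≤ W := SORL.weightedScatter_nonneg _ fun π hπ => by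
    obtain ⟨i, hi⟩ := Cls.nonempty_of_mem_parts hπ
    rw [← hlc π hπ i hi]
    exact SORL.labelVec_nonneg Pl T i
  have hη₁0 : 0 < η₁ := by rw [hη₁]; positivity
  have hη₂0 : 0 ≤ η₂ := by
    rw [hη₂]; exact div_nonneg (SORL.intraClass_nonneg _ _) hinter.le
  set I := SORL.intraClass Cls (SORL.features (E 0) hk)
  set J := SORL.interClass Cls (SORL.features (E 0) hk)
  -- Minus the derivative of the quotient is the main term plus the surplus `2 η₁ W` and the gap
  -- errors.
  have hder : -((-(2 * W) + a) / J - I * (S + b) / J ^ 2)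
      = η₁ * η₂ * S + η₁ * (2 * W - a + η₂ * b) := by
    rw [hη₁, hη₂]
    field_simp
    ring
  have herr : -((4 * (N : ℝ) ^ 4 + 1) * (1 + η₂) * g) ≤ -a + η₂ * b := by
    have h1 := (abs_le.mp ha).2
    have h2 := mul_le_mul_of_nonneg_left (abs_le.mp hb).1 hη₂0
    nlinarith [mul_nonneg hη₂0 hg0]
  constructor
  · obtain ⟨C, -, hC⟩ := hf.exists_eventually_le
    refine ⟨C, ?_⟩
    filter_upwards [hC, self_mem_nhdsWithin] with δ h hδ
    have hδ' : 0 < δ := hδ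
    rw [hder] at h
    -- Part 1 discards the surplus, using only `0 ≤ W`.
    have h1 : 0 ≤ δ * η₁ * (2 * W - a + η₂ * b + (4 * (N : ℝ) ^ 4 + 1) * (1 + η₂) * g) :=
      mul_nonneg (mul_nonneg hδ'.le hη₁0.le) (by linarith)
    linarith
  · intro hlt
    -- In part 2 the gap error is smaller than `W`, so the surplus `2 W` leaves more than `W ≥ 0`.
    -- This strict margin of order `δ` absorbs the quadratic remainder.
    have hm : η₁ * η₂ * S < -((-(2 * W) + a) / J - I * (S + b) / J ^ 2) := by
      rw [hder]
      have : 0 < η₁ * (2 * W - a + η₂ * b) := mul_pos hη₁0 (by linarith)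
      linarith
    filter_upwards [hf.eventually_le hm] with δ h
    linarith
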